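/- Let $\Gamma$ be a finite graph without loops and multiple edges, with vertex set $V$ and adjacency matrix $\varepsilon$. A path of length $\gamma$ is a tuple $(i_1,\dots,i_{\gamma+1})\in V^{\gamma+1}$ such that $i_a$ and $i_{a+1}$ are adjacent for $a=1,\dots,\gamma$ (vertices may repeat). Let $E^{\gamma}$ be the set of paths of length $\gamma$, and let $C(E^{\gamma})$ be the $C^*$-algebra of complex functions on $E^\gamma$, regarded (by extension by zero) as the subspace of $C(V)^{\otimes(\gamma+1)}\cong C(V^{\gamma+1})$ spanned by the indicator functions $\chi_{i_1\dots i_{\gamma+1}}=\chi_{i_1}\otimes\cdots\otimes\chi_{i_{\gamma+1}}$ of paths. For $k\in\mathbb N$ let $C(\mathbb G_k^+(\Gamma))$ be the universal unital $C^*$-algebra generated by self-adjoint elements $q_{ij}$ ($i,j\in V$) with the relations $$\sum_j q_{ij}=1=\sum_j q_{ji},\qquad q_{ij}q_{il}=\delta_{jl}q_{ij},\qquad q_{ji}q_{li}=\delta_{jl}q_{ji},\qquad q\varepsilon=\varepsilon q,$$ and $$q_{i_1j_1}q_{i_2j_2}\cdots q_{i_\beta j_\beta}=q_{i_\beta j_\beta}\cdots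 q_{i_2j_2}q_{i_1j_1}$$ for all $1\le\beta\le k+1$ and all paths $(i_1,\dots,i_\beta)$ and $(j_1,\dots,j_\beta)$ in $\Gamma$. With the comultiplication $\Delta(q_{ij})=\sum_{l} q_{il}\otimes q_{lj}$ it is a compact quantum group, denoted $\mathbb G_k^+(\Gamma)$. A $C^*$-coaction of $\mathbb G_k^+(\Gamma)$ on a unital $C^*$-algebra $A$ is a unital $*$-homomorphism $\alpha:A\to A\otimes_{\min}C(\mathbb G_k^+(\Gamma))$ such that $(\mathrm{id}\otimes\Delta)\circ\alpha=(\alpha\otimes\mathrm{id})\circ\alpha$ and the linear span of $\alpha(A)(1\otimes C(\mathbb G_k^+(\Gamma)))$ is norm dense in $A\otimes_{\min}C(\mathbb G_k^+(\Gamma))$. Let $u^{\otimes m}:C(V)^{\otimes m}\to C(V)^{\otimes m}\otimes C(\mathbb G_k^+(\Gamma))$ (algebraic tensor product) be the linear map $$u^{\otimes m}(\chi_{i_1\dots i_m})=\sum_{j_1,\dots,j_m\in V}\chi_{j_1\dots j_m}\otimes q_{j_1i_1}\cdots q_{j_mi_m}.$$ Lemma. For all $\gamma\le k$, the map $u^{\otimes(\gamma+1)}$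 sends $C(E^\gamma)$ into $C(E^\gamma)\otimes C(\mathbb G_k^+(\Gamma))$, and its restriction to $C(E^\gamma)$, viewed as a map into $C(E^\gamma)\otimes_{\min}C(\mathbb G_k^+(\Gamma))$, is a $C^*$-coaction of $\mathbb G_k^+(\Gamma)$ on the $C^*$-algebra $C(E^\gamma)$. In particular it is a unital $*$-homomorphism. -/

import Mathlib

open scoped TensorProduct InnerProductSpace

set_option linter.unusedSectionVars false

universe u

noncomputable section

/-! ### Enveloping C⋆-algebras of families of representations -/

/-- A pointwise bounded family of unital `*`-homomorphisms from a unital complex `*`-algebra `𝒜`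
to unital C⋆-algebras. -/
structure RepFamily (𝒜 : Type u) [Ring 𝒜] [StarRing 𝒜] [Algebra ℂ 𝒜] where
  Idx : Type (u + 1)
  alg : Idx → Type u
  [cstar : ∀ i, CStarAlgebra (alg i)]
  hom : ∀ i, 𝒜 →⋆ₐ[ℂ] alg i
  bdd : ∀ a, BddAbove (Set.range fun i => ‖hom i a‖)

attribute [instance] RepFamily.cstar

namespace RepFamily

section

variable {𝒜 : Type u} [Ring 𝒜] [StarRing 𝒜] [Algebra ℂ 𝒜] (F : RepFamily 𝒜)

/-- The C⋆-seminorm `a ↦ sup_i ‖φ_i a‖` of the family. -/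
def seminorm (a : 𝒜) : ℝ := ⨆ i, ‖F.hom i a‖

lemma norm_hom_le (i : F.Idx) (a : 𝒜) : ‖F.hom i a‖ ≤ F.seminorm a := le_ciSup (F.bdd a) i

lemma seminorm_nonneg (a : 𝒜) : 0 ≤ F.seminorm a := Real.iSup_nonneg fun _ => norm_nonneg _

lemma seminorm_le {a : 𝒜} {c : ℝ} (hc : 0 ≤ c) (h : ∀ i, ‖F.hom i a‖ ≤ c) : F.seminorm a ≤ c :=
  Real.iSup_le h hc

/-- The `*`-algebra `𝒜`, equipped with the seminorm of the family. -/
def Pre (_F : RepFamily 𝒜) : Type u := 𝒜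

instance : Ring F.Pre := inferInstanceAs (Ring 𝒜)
instance : StarRing F.Pre := inferInstanceAs (StarRing 𝒜)
instance : Algebra ℂ F.Pre := inferInstanceAs (Algebra ℂ 𝒜)

/-- The underlying ring seminorm. -/
def ringSeminorm : RingSeminorm F.Pre where
  toFun a := F.seminorm (a : 𝒜)
  map_zero' := by
    refine le_antisymm (F.seminorm_le le_rfl fun i => ?_) (F.seminorm_nonneg _)
    exact (by rw [map_zero, norm_zero] : ‖F.hom i (0 : 𝒜)‖ = 0).le
  add_le' a b := by
    refine F.seminorm_le (add_nonneg (F.seminorm_nonneg _) (F.seminorm_nonneg _)) fun i => ?_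
    refine (congrArg norm (map_add (F.hom i) a b)).trans_le ((norm_add_le _ _).trans ?_)
    exact add_le_add (F.norm_hom_le i a) (F.norm_hom_le i b)
  neg' a := by
    refine congrArg iSup (funext fun i => ?_)
    exact (congrArg norm (map_neg (F.hom i) a)).trans (norm_neg _)
  mul_le' a b := by
    refine F.seminorm_le (mul_nonneg (F.seminorm_nonneg _) (F.seminorm_nonneg _)) fun i => ?_
    refine (congrArg norm (map_mul (F.hom i) a b)).trans_le ((norm_mul_le _ _).trans ?_)
    exact mul_le_mul (F.norm_hom_le i a) (F.norm_hom_le i b) (norm_nonneg _) (F.seminorm_nonneg _)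

instance : SeminormedRing F.Pre :=
  { F.ringSeminorm.toSeminormedRing with toRing := inferInstanceAs (Ring F.Pre) }

lemma norm_pre (a : F.Pre) : ‖a‖ = F.seminorm (a : 𝒜) := rfl

instance : NormedAlgebra ℂ F.Pre where
  norm_smul_le c a := by
    refine F.seminorm_le (mul_nonneg (norm_nonneg _) (F.seminorm_nonneg _)) fun i => ?_
    refine (congrArg norm (map_smul (F.hom i) c a)).trans_le ?_
    rw [norm_smul]
    exact mul_le_mul_of_nonneg_left (F.norm_hom_le i a) (norm_nonneg _)

lemma norm_star_pre (a : F.Pre) : ‖star a‖ = ‖a‖ := by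
  refine congrArg iSup (funext fun i => ?_)
  exact (congrArg norm (map_star (F.hom i) a)).trans (norm_star _)

lemma norm_sq_le_pre (a : F.Pre) : ‖a‖ * ‖a‖ ≤ ‖star a * a‖ := by
  have h : ‖a‖ ≤ √‖star a * a‖ := by
    refine F.seminorm_le (Real.sqrt_nonneg _) fun i => Real.le_sqrt_of_sq_le ?_
    have h1 := F.norm_hom_le i (star a * a : F.Pre)
    have h2 : F.hom i (star a * a : F.Pre) = star (F.hom i a) * F.hom i a :=
      (map_mul (F.hom i) _ _).trans (congrArg (· * F.hom i a) (map_star (F.hom i) a))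
    rw [h2, CStarRing.norm_star_mul_self, ← sq] at h1
    exact h1
  calc ‖a‖ * ‖a‖ ≤ √‖star a * a‖ * √‖star a * a‖ :=
        mul_le_mul h h (norm_nonneg _) (Real.sqrt_nonneg _)
    _ = _ := Real.mul_self_sqrt (norm_nonneg _)

instance : NormedStarGroup F.Pre := ⟨fun a => (F.norm_star_pre a).le⟩

/-- The enveloping C⋆-algebra of the family: the separated completion of `𝒜` with respect to the
C⋆-seminorm `a ↦ sup_i ‖φ_i a‖`. -/
def Env : Type u := UniformSpace.Completion F.Pre

namespace Env

open UniformSpace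

instance : NormedRing F.Env := inferInstanceAs (NormedRing (Completion F.Pre))
instance : CompleteSpace F.Env := inferInstanceAs (CompleteSpace (Completion F.Pre))

instance : NormedAlgebra ℂ F.Env where
  toAlgebra := inferInstanceAs (Algebra ℂ (Completion F.Pre))
  norm_smul_le c x := norm_smul_le (α := ℂ) (β := Completion F.Pre) c x

/-- The canonical map of `𝒜` into its completion. -/
def coe (a : 𝒜) : F.Env := Completion.coe' (α := F.Pre) a

lemma norm_coe (a : 𝒜) : ‖coe F a‖ = F.seminorm a := Completion.norm_coe (E := F.Pre) a

lemma denseRange_coe : DenseRange (coe F) := Completion.denseRange_coe (α := F.Pre)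

@[elab_as_elim]
lemma induction_on {p : F.Env → Prop} (x : F.Env) (hp : IsClosed {x | p x})
    (h : ∀ a, p (coe F a)) : p x :=
  Completion.induction_on (α := F.Pre) x hp h

lemma coe_mul (a b : 𝒜) : coe F (a * b) = coe F a * coe F b :=
  Completion.coe_mul (α := F.Pre) a b
lemma coe_add (a b : 𝒜) : coe F (a + b) = coe F a + coe F b :=
  Completion.coe_add (α := F.Pre) a b

instance : Star F.Env := ⟨Completion.map (star : F.Pre → F.Pre)⟩

lemma uniformContinuous_star_pre : UniformContinuous (star : F.Pre → F.Pre) :=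
  (starNormedAddGroupHom (E := F.Pre)).uniformContinuous

lemma continuous_star' : Continuous (star : F.Env → F.Env) :=
  Completion.continuous_map (α := F.Pre) (β := F.Pre)

lemma coe_star (a : 𝒜) : coe F (star a) = star (coe F a) :=
  (Completion.map_coe (uniformContinuous_star_pre F) (a : F.Pre)).symm

instance : StarRing F.Env where
  star_involutive x := by
    refine induction_on F x (isClosed_eq ((continuous_star' F).comp (continuous_star' F))
      continuous_id) fun a => ?_
    rw [← coe_star, ← coe_star, star_star]
  star_mul x y := by
    refine induction_on F x (isClosed_eq ((continuous_star' F).comp (continuous_mul_const y))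
      (continuous_const.mul (continuous_star' F))) fun a => ?_
    refine induction_on F y (isClosed_eq ((continuous_star' F).comp (continuous_const_mul (coe F a)))
      ((continuous_star' F).mul continuous_const)) fun b => ?_
    rw [← coe_mul, ← coe_star, ← coe_star, ← coe_star, star_mul, coe_mul]
  star_add x y := by
    refine induction_on F x (isClosed_eq ((continuous_star' F).comp (continuous_id.add continuous_const))
      ((continuous_star' F).add continuous_const)) fun a => ?_
    refine induction_on F y (isClosed_eq ((continuous_star' F).comp (continuous_const.add continuous_id))
      (continuous_const.add (continuous_star' F))) fun b => ?_
    rw [← coe_add, ← coe_star, ← coe_star, ← coe_star, star_add, coe_add]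

instance : CStarRing F.Env where
  norm_mul_self_le x := by
    refine induction_on F x (isClosed_le (by fun_prop)
      (((continuous_star' F).mul continuous_id).norm)) fun a => ?_
    rw [← coe_star, ← coe_mul, norm_coe, norm_coe]
    exact F.norm_sq_le_pre a

lemma coe_smul (c : ℂ) (a : 𝒜) : coe F (c • a) = c • coe F a :=
  Completion.coe_smul (X := F.Pre) c a

lemma continuous_smul' (c : ℂ) : Continuous fun x : F.Env => c • x :=
  Completion.continuous_map (α := F.Pre) (β := F.Pre) (f := fun x => c • x)

lemma star_smul' [StarModule ℂ 𝒜] (c : ℂ) (x : F.Env) : star (c • x) = star c • star x := by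
  refine induction_on F x (isClosed_eq ((continuous_star' F).comp (continuous_smul' F c))
    ((continuous_smul' F (star c)).comp (continuous_star' F))) fun a => ?_
  rw [← coe_smul, ← coe_star, ← coe_star, star_smul, coe_smul]

instance [StarModule ℂ 𝒜] : CStarAlgebra F.Env where
  star_smul := star_smul' F

end Env

end

variable {𝒜 : Type u} [Ring 𝒜] [StarRing 𝒜] [Algebra ℂ 𝒜] [StarModule ℂ 𝒜] (F : RepFamily 𝒜)

/-- The canonical unital `*`-homomorphism from `𝒜` to its enveloping C⋆-algebra. -/
def toEnv : 𝒜 →⋆ₐ[ℂ] F.Env where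
  toFun := Env.coe F
  map_one' := rfl
  map_zero' := rfl
  map_mul' := Env.coe_mul F
  map_add' := Env.coe_add F
  commutes' _ := rfl
  map_star' := Env.coe_star F

lemma norm_toEnv (a : 𝒜) : ‖F.toEnv a‖ = F.seminorm a := Env.norm_coe F a

lemma denseRange_toEnv : DenseRange F.toEnv := Env.denseRange_coe F

variable {F} in
@[elab_as_elim]
lemma env_induction {p : F.Env → Prop} (x : F.Env) (hp : IsClosed {x | p x})
    (h : ∀ a, p (F.toEnv a)) : p x :=
  Env.induction_on F x hp h

/-- A `*`-homomorphism on `𝒜`, as a ring homomorphism on the seminormed ring. -/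
def preHom {D : Type u} [CStarAlgebra D] (φ : 𝒜 →⋆ₐ[ℂ] D) : F.Pre →+* D :=
  (RingHomClass.toRingHom φ : 𝒜 →+* D)

lemma continuous_preHom {D : Type u} [CStarAlgebra D] (φ : 𝒜 →⋆ₐ[ℂ] D)
    (h : ∀ a, ‖φ a‖ ≤ F.seminorm a) : Continuous (F.preHom φ) :=
  AddMonoidHomClass.continuous_of_bound (F.preHom φ) 1
    fun a => (h a).trans_eq (one_mul (F.seminorm (a : 𝒜))).symm

/-- Extension by continuity, as a ring homomorphism. -/
def extendRingHom {D : Type u} [CStarAlgebra D] (φ : 𝒜 →⋆ₐ[ℂ] D)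
    (h : ∀ a, ‖φ a‖ ≤ F.seminorm a) : F.Env →+* D :=
  UniformSpace.Completion.extensionHom (F.preHom φ) (F.continuous_preHom φ h)

lemma extendRingHom_toEnv {D : Type u} [CStarAlgebra D] (φ : 𝒜 →⋆ₐ[ℂ] D)
    (h : ∀ a, ‖φ a‖ ≤ F.seminorm a) (a : 𝒜) : F.extendRingHom φ h (F.toEnv a) = φ a :=
  UniformSpace.Completion.extensionHom_coe (F.preHom φ) (F.continuous_preHom φ h) a

lemma continuous_extendRingHom {D : Type u} [CStarAlgebra D] (φ : 𝒜 →⋆ₐ[ℂ] D)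
    (h : ∀ a, ‖φ a‖ ≤ F.seminorm a) : Continuous (F.extendRingHom φ h) :=
  UniformSpace.Completion.continuous_extension (α := F.Pre)

/-- Extension by continuity of a unital `*`-homomorphism into a C⋆-algebra which is dominated by
the seminorm of the family. -/
def extend {D : Type u} [CStarAlgebra D] (φ : 𝒜 →⋆ₐ[ℂ] D) (h : ∀ a, ‖φ a‖ ≤ F.seminorm a) :
    F.Env →⋆ₐ[ℂ] D :=
  { F.extendRingHom φ h with
    commutes' := fun c => by
      have h1 : algebraMap ℂ F.Env c = F.toEnv (algebraMap ℂ 𝒜 c) :=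
        (AlgHomClass.commutes F.toEnv c).symm
      change F.extendRingHom φ h (algebraMap ℂ F.Env c) = _
      rw [h1, extendRingHom_toEnv]
      exact AlgHomClass.commutes φ c
    map_star' := fun x => by
      change F.extendRingHom φ h (star x) = star (F.extendRingHom φ h x)
      refine env_induction x (isClosed_eq ((F.continuous_extendRingHom φ h).comp
        continuous_star) (continuous_star.comp (F.continuous_extendRingHom φ h))) fun a => ?_
      rw [← map_star, extendRingHom_toEnv, extendRingHom_toEnv, map_star] }

@[simp]
lemma extend_toEnv {D : Type u} [CStarAlgebra D] (φ : 𝒜 →⋆ₐ[ℂ] D)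
    (h : ∀ a, ‖φ a‖ ≤ F.seminorm a) (a : 𝒜) : F.extend φ h (F.toEnv a) = φ a :=
  F.extendRingHom_toEnv φ h a

/-- The extension of a member of the family to the enveloping C⋆-algebra. -/
def homEnv (i : F.Idx) : F.Env →⋆ₐ[ℂ] F.alg i := F.extend (F.hom i) (F.norm_hom_le i)

lemma homEnv_toEnv (i : F.Idx) (a : 𝒜) : F.homEnv i (F.toEnv a) = F.hom i a :=
  F.extend_toEnv _ _ a

lemma norm_env_le {x : F.Env} {c : ℝ} (hc : 0 ≤ c) (h : ∀ i, ‖F.homEnv i x‖ ≤ c) : ‖x‖ ≤ c := by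
  refine le_of_forall_pos_le_add fun ε hε => ?_
  obtain ⟨a, ha⟩ := F.denseRange_toEnv.exists_dist_lt x (half_pos hε)
  rw [dist_eq_norm] at ha
  have h1 : ‖F.toEnv a‖ ≤ c + ε / 2 := by
    rw [norm_toEnv]
    refine F.seminorm_le (by positivity) fun i => ?_
    rw [← homEnv_toEnv]
    have h2 : F.homEnv i (F.toEnv a) = F.homEnv i x - F.homEnv i (x - F.toEnv a) := by
      rw [map_sub]; abel
    rw [h2]
    refine (norm_sub_le _ _).trans (add_le_add (h i) ?_)
    exact (NonUnitalStarAlgHom.norm_apply_le (F.homEnv i) _).trans ha.le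
  have h3 : x = F.toEnv a + (x - F.toEnv a) := by abel
  rw [h3]
  refine (norm_add_le _ _).trans ?_
  linarith

end RepFamily

/-! ### Minimal tensor products -/

section HilbertTensor

variable {H K : Type u} [NormedAddCommGroup H] [InnerProductSpace ℂ H]
  [NormedAddCommGroup K] [InnerProductSpace ℂ K]

/-- The Hilbert space tensor product: the completion of the algebraic tensor product with respect
to the inner product `⟪x ⊗ y, x' ⊗ y'⟫ = ⟪x, x'⟫ ⟪y, y'⟫`. -/
def HilbertTensor (H K : Type u) [NormedAddCommGroup H] [InnerProductSpace ℂ H]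
    [NormedAddCommGroup K] [InnerProductSpace ℂ K] : Type u :=
  UniformSpace.Completion (H ⊗[ℂ] K)

namespace HilbertTensor

variable (H K : Type u) [NormedAddCommGroup H] [InnerProductSpace ℂ H]
    [NormedAddCommGroup K] [InnerProductSpace ℂ K]

instance : NormedAddCommGroup (HilbertTensor H K) :=
  inferInstanceAs (NormedAddCommGroup (UniformSpace.Completion (H ⊗[ℂ] K)))
instance : InnerProductSpace ℂ (HilbertTensor H K) :=
  inferInstanceAs (InnerProductSpace ℂ (UniformSpace.Completion (H ⊗[ℂ] K)))
instance : CompleteSpace (HilbertTensor H K) :=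
  inferInstanceAs (CompleteSpace (UniformSpace.Completion (H ⊗[ℂ] K)))

/-- The inclusion of the algebraic tensor product. -/
def of : H ⊗[ℂ] K →ₗᵢ[ℂ] HilbertTensor H K :=
  UniformSpace.Completion.toComplₗᵢ (𝕜 := ℂ) (E := H ⊗[ℂ] K)

variable {H K}

lemma denseRange_of : DenseRange (of H K) :=
  UniformSpace.Completion.denseRange_coe (α := H ⊗[ℂ] K)

lemma clm_ext {F : Type u} [NormedAddCommGroup F] [InnerProductSpace ℂ F]
    {S T : HilbertTensor H K →L[ℂ] F} (h : ∀ x, S (of H K x) = T (of H K x)) : S = T := by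
  ext x
  exact denseRange_of.induction_on x (isClosed_eq S.continuous T.continuous) h

end HilbertTensor

/-- The tensor product `S ⊗ T` of two bounded operators. -/
def opTensor (S : H →L[ℂ] H) (T : K →L[ℂ] K) : HilbertTensor H K →L[ℂ] HilbertTensor H K :=
  ContinuousLinearMap.completion (TensorProduct.mapL S T)

lemma opTensor_of (S : H →L[ℂ] H) (T : K →L[ℂ] K) (x : H ⊗[ℂ] K) :
    opTensor S T (HilbertTensor.of H K x) = HilbertTensor.of H K (TensorProduct.mapL S T x) :=
  ContinuousLinearMap.completion_apply_coe (TensorProduct.mapL S T) x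

lemma opTensor_mul (S S' : H →L[ℂ] H) (T T' : K →L[ℂ] K) :
    opTensor (S * S') (T * T') = opTensor S T * opTensor S' T' :=
  HilbertTensor.clm_ext fun x => by
    rw [mul_apply_eq_comp, opTensor_of, opTensor_of, opTensor_of,
      TensorProduct.mapL_mul]
    rfl

lemma opTensor_one : opTensor (1 : H →L[ℂ] H) (1 : K →L[ℂ] K) = 1 :=
  HilbertTensor.clm_ext fun x => by
    rw [opTensor_of]
    exact congrArg _ (congrArg (· x) (TensorProduct.mapL_id_id (𝕜 := ℂ) (E := H) (G := K)))

end HilbertTensor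

section TensorRep

variable {𝒜 ℬ : Type u} [Ring 𝒜] [StarRing 𝒜] [Algebra ℂ 𝒜] [StarModule ℂ 𝒜]
  [Ring ℬ] [StarRing ℬ] [Algebra ℂ ℬ] [StarModule ℂ ℬ]
  {H K : Type u} [NormedAddCommGroup H] [InnerProductSpace ℂ H] [CompleteSpace H]
  [NormedAddCommGroup K] [InnerProductSpace ℂ K] [CompleteSpace K]

lemma star_opTensor (S : H →L[ℂ] H) (T : K →L[ℂ] K) :
    star (opTensor S T) = opTensor (star S) (star T) := by
  symm
  refine (ContinuousLinearMap.eq_adjoint_iff _ _).mpr fun x y => ?_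
  refine HilbertTensor.denseRange_of.induction_on₂
    (isClosed_eq (by fun_prop) (by fun_prop)) (fun x y => ?_) x y
  rw [opTensor_of, opTensor_of, LinearIsometry.inner_map_map, LinearIsometry.inner_map_map]
  induction x with
  | zero => simp
  | add x x' h h' => rw [map_add, inner_add_left, inner_add_left, h, h']
  | tmul a b =>
    induction y with
    | zero => simp
    | add y y' h h' => rw [map_add, inner_add_right, inner_add_right, h, h']
    | tmul c d =>
      rw [TensorProduct.mapL_tmul, TensorProduct.mapL_tmul, TensorProduct.inner_tmul,
        TensorProduct.inner_tmul, ContinuousLinearMap.star_eq_adjoint,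
        ContinuousLinearMap.star_eq_adjoint, ContinuousLinearMap.adjoint_inner_left,
        ContinuousLinearMap.adjoint_inner_left]

/-- `S ↦ S ⊗ 1`. -/
def leftAmpAlg : (H →L[ℂ] H) →ₐ[ℂ] (HilbertTensor H K →L[ℂ] HilbertTensor H K) :=
  AlgHom.ofLinearMap
    { toFun := fun S => opTensor S 1
      map_add' := fun S T => HilbertTensor.clm_ext fun x => by
        rw [_root_.add_apply, opTensor_of, opTensor_of, opTensor_of,
          TensorProduct.mapL_add_left, _root_.add_apply, map_add]
      map_smul' := fun c S => HilbertTensor.clm_ext fun x => by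
        rw [RingHom.id_apply, _root_.smul_apply, opTensor_of, opTensor_of,
          TensorProduct.mapL_smul_left, _root_.smul_apply, map_smul] }
    opTensor_one
    (fun S T => by
      change opTensor (S * T) 1 = opTensor S 1 * opTensor T 1
      rw [← opTensor_mul, one_mul])

/-- `S ↦ S ⊗ 1`. -/
def leftAmp : (H →L[ℂ] H) →⋆ₐ[ℂ] (HilbertTensor H K →L[ℂ] HilbertTensor H K) where
  toAlgHom := leftAmpAlg
  map_star' S := by
    have h := star_opTensor (H := H) (K := K) S 1
    rw [star_one] at h
    exact h.symm

/-- `T ↦ 1 ⊗ T`. -/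
def rightAmpAlg : (K →L[ℂ] K) →ₐ[ℂ] (HilbertTensor H K →L[ℂ] HilbertTensor H K) :=
  AlgHom.ofLinearMap
    { toFun := fun S => opTensor 1 S
      map_add' := fun S T => HilbertTensor.clm_ext fun x => by
        rw [_root_.add_apply, opTensor_of, opTensor_of, opTensor_of,
          TensorProduct.mapL_add_right, _root_.add_apply, map_add]
      map_smul' := fun c S => HilbertTensor.clm_ext fun x => by
        rw [RingHom.id_apply, _root_.smul_apply, opTensor_of, opTensor_of,
          TensorProduct.mapL_smul_right, _root_.smul_apply, map_smul] }
    opTensor_one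
    (fun S T => by
      change opTensor 1 (S * T) = opTensor 1 S * opTensor 1 T
      rw [← opTensor_mul, one_mul])

/-- `T ↦ 1 ⊗ T`. -/
def rightAmp : (K →L[ℂ] K) →⋆ₐ[ℂ] (HilbertTensor H K →L[ℂ] HilbertTensor H K) where
  toAlgHom := rightAmpAlg
  map_star' S := by
    have h := star_opTensor (H := H) (K := K) 1 S
    rw [star_one] at h
    exact h.symm

/-- Promote an algebra homomorphism on an algebraic tensor product to a `*`-homomorphism. -/
def starHomOfTensor {D : Type u} [CStarAlgebra D] (φ : 𝒜 ⊗[ℂ] ℬ →ₐ[ℂ] D)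
    (h : ∀ a b, φ (star a ⊗ₜ star b) = star (φ (a ⊗ₜ b))) : 𝒜 ⊗[ℂ] ℬ →⋆ₐ[ℂ] D :=
  { φ with
    map_star' := fun x => by
      change φ (star x) = star (φ x)
      induction x with
      | zero => simp
      | tmul a b => exact h a b
      | add x y hx hy => rw [star_add, map_add, map_add, star_add, hx, hy] }

/-- The `*`-homomorphism `a ⊗ b ↦ φ a * ψ b` for `*`-homomorphisms with commuting ranges. -/
def prodHom {D : Type u} [CStarAlgebra D] (φ : 𝒜 →⋆ₐ[ℂ] D) (ψ : ℬ →⋆ₐ[ℂ] D)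
    (h : ∀ a b, Commute (φ a) (ψ b)) : 𝒜 ⊗[ℂ] ℬ →⋆ₐ[ℂ] D :=
  starHomOfTensor (Algebra.TensorProduct.lift φ.toAlgHom ψ.toAlgHom h) fun a b => by
    rw [Algebra.TensorProduct.lift_tmul, Algebra.TensorProduct.lift_tmul]
    change φ (star a) * ψ (star b) = star (φ a * ψ b)
    rw [map_star, map_star, (h a b).eq, star_mul]

@[simp]
lemma prodHom_tmul {D : Type u} [CStarAlgebra D] (φ : 𝒜 →⋆ₐ[ℂ] D) (ψ : ℬ →⋆ₐ[ℂ] D)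
    (h : ∀ a b, Commute (φ a) (ψ b)) (a : 𝒜) (b : ℬ) :
    prodHom φ ψ h (a ⊗ₜ b) = φ a * ψ b :=
  Algebra.TensorProduct.lift_tmul φ.toAlgHom ψ.toAlgHom h a b

lemma commute_amp (S : H →L[ℂ] H) (T : K →L[ℂ] K) :
    Commute (leftAmp (K := K) S) (rightAmp (H := H) T) := by
  change opTensor S 1 * opTensor 1 T = opTensor 1 T * opTensor S 1
  rw [← opTensor_mul, ← opTensor_mul, one_mul, mul_one, one_mul, mul_one]

lemma commute_amp_comp (π : 𝒜 →⋆ₐ[ℂ] (H →L[ℂ] H)) (ρ : ℬ →⋆ₐ[ℂ] (K →L[ℂ] K)) (a : 𝒜) (b : ℬ) :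
    Commute ((leftAmp (K := K)).comp π a) ((rightAmp (H := H)).comp ρ b) :=
  commute_amp (π a) (ρ b)

/-- The tensor product `π ⊗ ρ` of two Hilbert space representations:
`(π ⊗ ρ)(a ⊗ b) = π a ⊗ ρ b` on the Hilbert space tensor product. -/
def tensorRep (π : 𝒜 →⋆ₐ[ℂ] (H →L[ℂ] H)) (ρ : ℬ →⋆ₐ[ℂ] (K →L[ℂ] K)) :
    𝒜 ⊗[ℂ] ℬ →⋆ₐ[ℂ] (HilbertTensor H K →L[ℂ] HilbertTensor H K) :=
  prodHom (D := HilbertTensor H K →L[ℂ] HilbertTensor H K) (leftAmp.comp π) (rightAmp.comp ρ) (commute_amp_comp π ρ)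

@[simp]
lemma tensorRep_tmul (π : 𝒜 →⋆ₐ[ℂ] (H →L[ℂ] H)) (ρ : ℬ →⋆ₐ[ℂ] (K →L[ℂ] K)) (a : 𝒜) (b : ℬ) :
    tensorRep π ρ (a ⊗ₜ b) = opTensor (π a) (ρ b) := by
  refine (prodHom_tmul (D := HilbertTensor H K →L[ℂ] HilbertTensor H K) _ _ _ a b).trans ?_
  change opTensor (π a) 1 * opTensor 1 (ρ b) = _
  rw [← opTensor_mul, one_mul, mul_one]

lemma starAlgHom_tensor_ext {D : Type u} [CStarAlgebra D]
    {φ ψ : 𝒜 ⊗[ℂ] ℬ →⋆ₐ[ℂ] D} (h : ∀ a b, φ (a ⊗ₜ b) = ψ (a ⊗ₜ b)) : φ = ψ := by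
  ext x
  induction x with
  | zero => simp
  | tmul a b => exact h a b
  | add x y hx hy => rw [map_add, map_add, hx, hy]

end TensorRep

/-- A unital `*`-representation of a C⋆-algebra on a Hilbert space. -/
structure HilbertRep (A : Type u) [CStarAlgebra A] : Type (u + 1) where
  space : Type u
  [normed : NormedAddCommGroup space]
  [innerProduct : InnerProductSpace ℂ space]
  [complete : CompleteSpace space]
  hom : A →⋆ₐ[ℂ] (space →L[ℂ] space)

attribute [instance] HilbertRep.normed HilbertRep.innerProduct HilbertRep.complete

/-- Every element has a bound on its image that is uniform over all `*`-homomorphisms into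
C⋆-algebras. -/
def HomBounded (𝒜 : Type u) [Ring 𝒜] [StarRing 𝒜] [Algebra ℂ 𝒜] : Prop :=
  ∀ x : 𝒜, ∃ c : ℝ, ∀ (D : Type u) (_ : CStarAlgebra D) (φ : 𝒜 →⋆ₐ[ℂ] D), ‖φ x‖ ≤ c

lemma homBounded_cstar (A : Type u) [CStarAlgebra A] : HomBounded A :=
  fun a => ⟨‖a‖, fun _ _ φ => NonUnitalStarAlgHom.norm_apply_le φ a⟩

lemma HomBounded.tensor {𝒜 ℬ : Type u} [Ring 𝒜] [StarRing 𝒜] [Algebra ℂ 𝒜] [StarModule ℂ 𝒜]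
    [Ring ℬ] [StarRing ℬ] [Algebra ℂ ℬ] [StarModule ℂ ℬ] (h𝒜 : HomBounded 𝒜)
    (hℬ : HomBounded ℬ) : HomBounded (𝒜 ⊗[ℂ] ℬ) := by
  intro x
  induction x with
  | zero => exact ⟨0, fun D _ φ => by rw [map_zero, norm_zero]⟩
  | add x y hx hy =>
    obtain ⟨c, hc⟩ := hx
    obtain ⟨d, hd⟩ := hy
    refine ⟨c + d, fun D i φ => ?_⟩
    rw [map_add]
    exact (norm_add_le _ _).trans (add_le_add (hc D i φ) (hd D i φ))
  | tmul a b =>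
    obtain ⟨c, hc⟩ := h𝒜 a
    obtain ⟨d, hd⟩ := hℬ b
    refine ⟨c * d, fun D i φ => ?_⟩
    let φ₁ : 𝒜 →⋆ₐ[ℂ] D :=
      { φ.toAlgHom.comp Algebra.TensorProduct.includeLeft with
        map_star' := fun a => by
          change φ (star a ⊗ₜ 1) = star (φ (a ⊗ₜ 1))
          rw [← map_star, TensorProduct.star_tmul, star_one] }
    let φ₂ : ℬ →⋆ₐ[ℂ] D :=
      { φ.toAlgHom.comp Algebra.TensorProduct.includeRight with
        map_star' := fun a => by
          change φ (1 ⊗ₜ star a) = star (φ (1 ⊗ₜ a))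
          rw [← map_star, TensorProduct.star_tmul, star_one] }
    have h : φ (a ⊗ₜ b) = φ₁ a * φ₂ b := by
      change φ (a ⊗ₜ b) = φ (a ⊗ₜ 1) * φ (1 ⊗ₜ b)
      rw [← map_mul, Algebra.TensorProduct.tmul_mul_tmul, one_mul, mul_one]
    rw [h]
    have h1 := hc D i φ₁
    have h2 := hd D i φ₂
    exact (norm_mul_le _ _).trans (mul_le_mul h1 h2 (norm_nonneg _) ((norm_nonneg _).trans h1))

/-- A family of representations of a `*`-algebra whose elements are uniformly bounded. -/
def RepFamily.ofHomBounded {𝒜 : Type u} [Ring 𝒜] [StarRing 𝒜] [Algebra ℂ 𝒜] (h : HomBounded 𝒜)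
    (ι : Type (u + 1)) (D : ι → Type u) [∀ i, CStarAlgebra (D i)] (φ : ∀ i, 𝒜 →⋆ₐ[ℂ] D i) :
    RepFamily 𝒜 where
  Idx := ι
  alg := D
  hom := φ
  bdd x := by
    obtain ⟨c, hc⟩ := h x
    exact ⟨c, by rintro _ ⟨i, rfl⟩; exact hc (D i) _ (φ i)⟩

/-- The representations `π ⊗ ρ` of the algebraic tensor product, where `π` and `ρ` run through
the Hilbert space representations of `A` and `B`. -/
def spatialFamily (A B : Type u) [CStarAlgebra A] [CStarAlgebra B] : RepFamily (A ⊗[ℂ] B) :=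
  .ofHomBounded ((homBounded_cstar A).tensor (homBounded_cstar B)) (HilbertRep A × HilbertRep B)
    (fun i => HilbertTensor i.1.space i.2.space →L[ℂ] HilbertTensor i.1.space i.2.space)
    (fun i => tensorRep i.1.hom i.2.hom)

/-- The minimal (spatial) tensor product `A ⊗_min B`: the completion of the algebraic tensor
product with respect to the norm `‖x‖_min = sup ‖(π ⊗ ρ)(x)‖`, the supremum being taken over all
Hilbert space representations `π` of `A` and `ρ` of `B`. -/
def MinTensor (A B : Type u) [CStarAlgebra A] [CStarAlgebra B] : Type u :=
  (spatialFamily A B).Env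

instance (A B : Type u) [CStarAlgebra A] [CStarAlgebra B] : CStarAlgebra (MinTensor A B) :=
  inferInstanceAs (CStarAlgebra (spatialFamily A B).Env)

namespace MinTensor

variable {A A' B B' C : Type u} [CStarAlgebra A] [CStarAlgebra A'] [CStarAlgebra B]
  [CStarAlgebra B'] [CStarAlgebra C]

/-- The canonical map from the algebraic to the minimal tensor product. -/
def ofAlg (A B : Type u) [CStarAlgebra A] [CStarAlgebra B] : A ⊗[ℂ] B →⋆ₐ[ℂ] MinTensor A B :=
  (spatialFamily A B).toEnv

/-- The elementary tensor `a ⊗ b` in `A ⊗_min B`. -/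
def tmul (a : A) (b : B) : MinTensor A B := ofAlg A B (a ⊗ₜ b)

lemma tmul_mul (a a' : A) (b b' : B) : tmul (a * a') (b * b') = tmul a b * tmul a' b' := by
  rw [tmul, tmul, tmul, ← map_mul, Algebra.TensorProduct.tmul_mul_tmul]

lemma tmul_one_one : tmul (1 : A) (1 : B) = 1 := map_one (ofAlg A B)

lemma star_tmul (a : A) (b : B) : star (tmul a b) = tmul (star a) (star b) := by
  rw [tmul, ← map_star, TensorProduct.star_tmul, tmul]

lemma add_tmul (a a' : A) (b : B) : tmul (a + a') b = tmul a b + tmul a' b := by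
  rw [tmul, TensorProduct.add_tmul, map_add]; rfl
lemma tmul_add (a : A) (b b' : B) : tmul a (b + b') = tmul a b + tmul a b' := by
  rw [tmul, TensorProduct.tmul_add, map_add]; rfl
lemma tmul_sum {ι : Type*} (s : Finset ι) (a : A) (b : ι → B) :
    tmul a (∑ i ∈ s, b i) = ∑ i ∈ s, tmul a (b i) := by
  rw [tmul, TensorProduct.tmul_sum, map_sum]; rfl
lemma sum_tmul {ι : Type*} (s : Finset ι) (a : ι → A) (b : B) :
    tmul (∑ i ∈ s, a i) b = ∑ i ∈ s, tmul (a i) b := by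
  rw [tmul, TensorProduct.sum_tmul, map_sum]; rfl
lemma smul_tmul (c : ℂ) (a : A) (b : B) : tmul (c • a) b = c • tmul a b := by
  rw [tmul, ← TensorProduct.smul_tmul', map_smul]; rfl
lemma tmul_smul (c : ℂ) (a : A) (b : B) : tmul a (c • b) = c • tmul a b := by
  rw [tmul, TensorProduct.tmul_smul, map_smul]; rfl
lemma zero_tmul (b : B) : tmul (0 : A) b = 0 := by
  rw [tmul, TensorProduct.zero_tmul, map_zero]
lemma tmul_zero (a : A) : tmul a (0 : B) = 0 := by
  rw [tmul, TensorProduct.tmul_zero, map_zero]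

/-- `a ↦ a ⊗ 1`. -/
def inclLeft : A →⋆ₐ[ℂ] MinTensor A B where
  toFun a := tmul a 1
  map_one' := tmul_one_one
  map_mul' a b := by rw [← tmul_mul, one_mul]
  map_zero' := zero_tmul _
  map_add' a b := add_tmul a b 1
  commutes' c := by
    rw [Algebra.algebraMap_eq_smul_one, Algebra.algebraMap_eq_smul_one, smul_tmul, tmul_one_one]
  map_star' a := by rw [star_tmul, star_one]

/-- `b ↦ 1 ⊗ b`. -/
def inclRight : B →⋆ₐ[ℂ] MinTensor A B where
  toFun b := tmul 1 b
  map_one' := tmul_one_one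
  map_mul' a b := by rw [← tmul_mul, one_mul]
  map_zero' := tmul_zero _
  map_add' a b := tmul_add 1 a b
  commutes' c := by
    rw [Algebra.algebraMap_eq_smul_one, Algebra.algebraMap_eq_smul_one, tmul_smul, tmul_one_one]
  map_star' a := by rw [star_tmul, star_one]

lemma induction_on {p : MinTensor A B → Prop} (x : MinTensor A B) (hp : IsClosed {x | p x})
    (h : ∀ a, p (ofAlg A B a)) : p x :=
  RepFamily.env_induction x hp h

lemma continuous_starAlgHom (φ : A →⋆ₐ[ℂ] B) : Continuous φ :=
  (AddMonoidHomClass.continuous_of_bound φ 1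
    fun a => (NonUnitalStarAlgHom.norm_apply_le φ a).trans_eq (one_mul _).symm)

/-- Unital `*`-homomorphisms on `A ⊗_min B` are determined by their values on elementary tensors. -/
lemma hom_ext {φ ψ : MinTensor A B →⋆ₐ[ℂ] C} (h : ∀ a b, φ (tmul a b) = ψ (tmul a b)) :
    φ = ψ := by
  ext x
  refine induction_on x (isClosed_eq (continuous_starAlgHom φ) (continuous_starAlgHom ψ))
    fun y => ?_
  have h2 : φ.comp (ofAlg A B) = ψ.comp (ofAlg A B) := starAlgHom_tensor_ext h
  exact DFunLike.congr_fun h2 y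

/-- The extension of `π ⊗ ρ` to the minimal tensor product. -/
def rep (π : HilbertRep A) (ρ : HilbertRep B) : MinTensor A B →⋆ₐ[ℂ]
    (HilbertTensor π.space ρ.space →L[ℂ] HilbertTensor π.space ρ.space) :=
  (spatialFamily A B).homEnv (π, ρ)

lemma rep_ofAlg (π : HilbertRep A) (ρ : HilbertRep B) (x : A ⊗[ℂ] B) :
    rep π ρ (ofAlg A B x) = tensorRep π.hom ρ.hom x :=
  (spatialFamily A B).homEnv_toEnv (π, ρ) x

lemma rep_tmul (π : HilbertRep A) (ρ : HilbertRep B) (a : A) (b : B) :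
    rep π ρ (tmul a b) = opTensor (π.hom a) (ρ.hom b) :=
  (rep_ofAlg π ρ _).trans (tensorRep_tmul _ _ _ _)

lemma norm_le {x : MinTensor A B} {c : ℝ} (hc : 0 ≤ c)
    (h : ∀ (π : HilbertRep A) (ρ : HilbertRep B), ‖rep π ρ x‖ ≤ c) : ‖x‖ ≤ c :=
  (spatialFamily A B).norm_env_le hc fun i => h i.1 i.2

lemma norm_tensorRep_le (x : A ⊗[ℂ] B) (π : HilbertRep A) (ρ : HilbertRep B) :
    ‖tensorRep π.hom ρ.hom x‖ ≤ (spatialFamily A B).seminorm x :=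
  (spatialFamily A B).norm_hom_le (π, ρ) x

/-- The `*`-homomorphism `a ⊗ b ↦ φ a * ψ b` on `A ⊗_min B` for `*`-homomorphisms with commuting
ranges, provided that it is bounded by the minimal norm. -/
def lift (φ : A →⋆ₐ[ℂ] C) (ψ : B →⋆ₐ[ℂ] C) (h : ∀ a b, Commute (φ a) (ψ b))
    (hb : ∀ x, ‖prodHom φ ψ h x‖ ≤ (spatialFamily A B).seminorm x) : MinTensor A B →⋆ₐ[ℂ] C :=
  (spatialFamily A B).extend (prodHom φ ψ h) hb

@[simp]
lemma lift_tmul (φ : A →⋆ₐ[ℂ] C) (ψ : B →⋆ₐ[ℂ] C) (h : ∀ a b, Commute (φ a) (ψ b))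
    (hb : ∀ x, ‖prodHom φ ψ h x‖ ≤ (spatialFamily A B).seminorm x) (a : A) (b : B) :
    lift φ ψ h hb (tmul a b) = φ a * ψ b :=
  ((spatialFamily A B).extend_toEnv _ _ _).trans (prodHom_tmul φ ψ h a b)

lemma inclLeft_apply (a : A) : inclLeft (B := B) a = tmul a 1 := rfl
lemma inclRight_apply (b : B) : inclRight (A := A) b = tmul 1 b := rfl

lemma commute_incl (a : A) (b : B) :
    Commute (inclLeft (B := B) a) (inclRight (A := A) b) := by
  change tmul a 1 * tmul 1 b = tmul 1 b * tmul a 1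
  rw [← tmul_mul, ← tmul_mul, one_mul, mul_one, one_mul, mul_one]

lemma commute_incl_comp (f : A →⋆ₐ[ℂ] A') (g : B →⋆ₐ[ℂ] B') (a : A) (b : B) :
    Commute ((inclLeft (B := B').comp f) a) ((inclRight (A := A').comp g) b) :=
  commute_incl (f a) (g b)

lemma map_bound (f : A →⋆ₐ[ℂ] A') (g : B →⋆ₐ[ℂ] B') (x : A ⊗[ℂ] B) :
    ‖prodHom ((inclLeft (B := B')).comp f) ((inclRight (A := A')).comp g) (commute_incl_comp f g) x‖ ≤
      (spatialFamily A B).seminorm x := by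
  refine norm_le ((spatialFamily A B).seminorm_nonneg x) fun π ρ => ?_
  have key : (rep π ρ).comp (prodHom ((inclLeft (B := B')).comp f) ((inclRight (A := A')).comp g)
      (commute_incl_comp f g)) = tensorRep (π.hom.comp f) (ρ.hom.comp g) := by
    refine starAlgHom_tensor_ext (D := HilbertTensor π.space ρ.space →L[ℂ]
      HilbertTensor π.space ρ.space) fun a b => ?_
    refine Eq.trans ?_ (tensorRep_tmul (π.hom.comp f) (ρ.hom.comp g) a b).symm
    refine Eq.trans ?_ (rep_tmul π ρ (f a) (g b))
    refine congrArg (rep π ρ) ((prodHom_tmul (D := MinTensor A' B') _ _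
      (commute_incl_comp f g) a b).trans ?_)
    change tmul (f a) 1 * tmul 1 (g b) = _
    rw [← tmul_mul, one_mul, mul_one]
  refine le_of_eq_of_le (congrArg norm (DFunLike.congr_fun key x)) ?_
  exact norm_tensorRep_le x ⟨π.space, π.hom.comp f⟩ ⟨ρ.space, ρ.hom.comp g⟩

/-- The functoriality `f ⊗ g : A ⊗_min B → A' ⊗_min B'`, `a ⊗ b ↦ f a ⊗ g b`. -/
def map (f : A →⋆ₐ[ℂ] A') (g : B →⋆ₐ[ℂ] B') : MinTensor A B →⋆ₐ[ℂ] MinTensor A' B' :=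
  lift ((inclLeft (B := B')).comp f) ((inclRight (A := A')).comp g) (commute_incl_comp f g) (map_bound f g)

@[simp]
lemma map_tmul (f : A →⋆ₐ[ℂ] A') (g : B →⋆ₐ[ℂ] B') (a : A) (b : B) :
    map f g (tmul a b) = tmul (f a) (g b) := by
  rw [map, lift_tmul, StarAlgHom.comp_apply, StarAlgHom.comp_apply, inclLeft_apply,
    inclRight_apply, ← tmul_mul, one_mul, mul_one]

end MinTensor

/-! ### Triple minimal tensor products -/

/-- The representations `π ⊗ ρ ⊗ τ` of the algebraic triple tensor product. -/
def spatialFamily₃ (A B C : Type u) [CStarAlgebra A] [CStarAlgebra B] [CStarAlgebra C] :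
    RepFamily (A ⊗[ℂ] (B ⊗[ℂ] C)) :=
  .ofHomBounded (HomBounded.tensor (homBounded_cstar A)
      (HomBounded.tensor (homBounded_cstar B) (homBounded_cstar C)))
    (HilbertRep A × HilbertRep B × HilbertRep C)
    (fun i => HilbertTensor i.1.space (HilbertTensor i.2.1.space i.2.2.space) →L[ℂ]
      HilbertTensor i.1.space (HilbertTensor i.2.1.space i.2.2.space))
    (fun i => tensorRep i.1.hom (tensorRep i.2.1.hom i.2.2.hom))

/-- The minimal tensor product `A ⊗_min B ⊗_min C` of three C⋆-algebras: the completion of the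
algebraic tensor product with respect to the norm `sup ‖(π ⊗ ρ ⊗ τ)(x)‖`, the supremum being taken
over all Hilbert space representations `π` of `A`, `ρ` of `B` and `τ` of `C`. -/
def MinTensor₃ (A B C : Type u) [CStarAlgebra A] [CStarAlgebra B] [CStarAlgebra C] : Type u :=
  (spatialFamily₃ A B C).Env

instance (A B C : Type u) [CStarAlgebra A] [CStarAlgebra B] [CStarAlgebra C] :
    CStarAlgebra (MinTensor₃ A B C) :=
  inferInstanceAs (CStarAlgebra (spatialFamily₃ A B C).Env)

namespace MinTensor₃

variable {A B C : Type u} [CStarAlgebra A] [CStarAlgebra B] [CStarAlgebra C]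

/-- The canonical map from the algebraic triple tensor product. -/
def ofAlg (A B C : Type u) [CStarAlgebra A] [CStarAlgebra B] [CStarAlgebra C] :
    A ⊗[ℂ] (B ⊗[ℂ] C) →⋆ₐ[ℂ] MinTensor₃ A B C :=
  (spatialFamily₃ A B C).toEnv

/-- The elementary tensor `a ⊗ b ⊗ c`. -/
def tmul (a : A) (b : B) (c : C) : MinTensor₃ A B C := ofAlg A B C (a ⊗ₜ (b ⊗ₜ c))

lemma tmul_mul (a a' : A) (b b' : B) (c c' : C) :
    tmul (a * a') (b * b') (c * c') = tmul a b c * tmul a' b' c' := by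
  rw [tmul, tmul, tmul, ← map_mul, Algebra.TensorProduct.tmul_mul_tmul,
    Algebra.TensorProduct.tmul_mul_tmul]

lemma tmul_one : tmul (1 : A) (1 : B) (1 : C) = 1 := map_one (ofAlg A B C)

lemma star_tmul (a : A) (b : B) (c : C) :
    star (tmul a b c) = tmul (star a) (star b) (star c) := by
  rw [tmul, ← map_star, TensorProduct.star_tmul, TensorProduct.star_tmul, tmul]

/-- `a ↦ a ⊗ 1 ⊗ 1`. -/
def incl₁ : A →⋆ₐ[ℂ] MinTensor₃ A B C where
  toFun a := tmul a 1 1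
  map_one' := tmul_one
  map_mul' a b := by rw [← tmul_mul, one_mul, one_mul]
  map_zero' := by rw [tmul, TensorProduct.zero_tmul, map_zero]
  map_add' a b := by rw [tmul, TensorProduct.add_tmul, map_add]; rfl
  commutes' c := by
    rw [Algebra.algebraMap_eq_smul_one, Algebra.algebraMap_eq_smul_one, tmul,
      ← TensorProduct.smul_tmul', map_smul, ← tmul_one]; rfl
  map_star' a := by rw [star_tmul, star_one, star_one]

/-- `b ↦ 1 ⊗ b ⊗ 1`. -/
def incl₂ : B →⋆ₐ[ℂ] MinTensor₃ A B C where
  toFun b := tmul 1 b 1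
  map_one' := tmul_one
  map_mul' a b := by rw [← tmul_mul, one_mul, one_mul]
  map_zero' := by rw [tmul, TensorProduct.zero_tmul, TensorProduct.tmul_zero, map_zero]
  map_add' a b := by rw [tmul, TensorProduct.add_tmul, TensorProduct.tmul_add, map_add]; rfl
  commutes' c := by
    rw [Algebra.algebraMap_eq_smul_one, Algebra.algebraMap_eq_smul_one, tmul,
      ← TensorProduct.smul_tmul', TensorProduct.tmul_smul, map_smul, ← tmul_one]; rfl
  map_star' a := by rw [star_tmul, star_one, star_one]

/-- `c ↦ 1 ⊗ 1 ⊗ c`. -/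
def incl₃ : C →⋆ₐ[ℂ] MinTensor₃ A B C where
  toFun c := tmul 1 1 c
  map_one' := tmul_one
  map_mul' a b := by rw [← tmul_mul, one_mul, one_mul]
  map_zero' := by rw [tmul, TensorProduct.tmul_zero, TensorProduct.tmul_zero, map_zero]
  map_add' a b := by rw [tmul, TensorProduct.tmul_add, TensorProduct.tmul_add, map_add]; rfl
  commutes' c := by
    rw [Algebra.algebraMap_eq_smul_one, Algebra.algebraMap_eq_smul_one, tmul,
      TensorProduct.tmul_smul, TensorProduct.tmul_smul, map_smul, ← tmul_one]; rfl
  map_star' a := by rw [star_tmul, star_one, star_one]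

lemma commute₁₂ (a : A) (b : B) :
    Commute (incl₁ (B := B) (C := C) a) (incl₂ (A := A) (C := C) b) := by
  change tmul a 1 1 * tmul 1 b 1 = tmul 1 b 1 * tmul a 1 1
  rw [← tmul_mul, ← tmul_mul]; simp only [one_mul, mul_one]

lemma commute₁₃ (a : A) (c : C) :
    Commute (incl₁ (B := B) (C := C) a) (incl₃ (A := A) (B := B) c) := by
  change tmul a 1 1 * tmul 1 1 c = tmul 1 1 c * tmul a 1 1
  rw [← tmul_mul, ← tmul_mul]; simp only [one_mul, mul_one]

lemma commute₂₃ (b : B) (c : C) :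
    Commute (incl₂ (A := A) (C := C) b) (incl₃ (A := A) (B := B) c) := by
  change tmul 1 b 1 * tmul 1 1 c = tmul 1 1 c * tmul 1 b 1
  rw [← tmul_mul, ← tmul_mul]; simp only [one_mul, mul_one]

lemma incl_mul_incl_mul_incl (a : A) (b : B) (c : C) :
    incl₁ a * (incl₂ b * incl₃ c) = tmul a b c := by
  change tmul a 1 1 * (tmul 1 b 1 * tmul 1 1 c) = _
  rw [← tmul_mul, ← tmul_mul]; simp only [one_mul, mul_one]

/-- The extension of `π ⊗ ρ ⊗ τ` to the minimal tensor product. -/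
def rep (π : HilbertRep A) (ρ : HilbertRep B) (τ : HilbertRep C) : MinTensor₃ A B C →⋆ₐ[ℂ]
    (HilbertTensor π.space (HilbertTensor ρ.space τ.space) →L[ℂ]
      HilbertTensor π.space (HilbertTensor ρ.space τ.space)) :=
  (spatialFamily₃ A B C).homEnv (π, ρ, τ)

lemma rep_tmul (π : HilbertRep A) (ρ : HilbertRep B) (τ : HilbertRep C) (a : A) (b : B) (c : C) :
    rep π ρ τ (tmul a b c) = opTensor (π.hom a) (opTensor (ρ.hom b) (τ.hom c)) := by
  refine ((spatialFamily₃ A B C).homEnv_toEnv (π, ρ, τ) _).trans ?_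
  refine (tensorRep_tmul _ _ _ _).trans ?_
  exact congrArg _ (tensorRep_tmul _ _ _ _)

lemma rep_incl₁ (π : HilbertRep A) (ρ : HilbertRep B) (τ : HilbertRep C) (a : A) :
    rep π ρ τ (incl₁ a) = leftAmp (π.hom a) := by
  refine (rep_tmul π ρ τ a 1 1).trans ?_
  rw [map_one, map_one, opTensor_one]; rfl

lemma norm_le {x : MinTensor₃ A B C} {c : ℝ} (hc : 0 ≤ c)
    (h : ∀ (π : HilbertRep A) (ρ : HilbertRep B) (τ : HilbertRep C), ‖rep π ρ τ x‖ ≤ c) :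
    ‖x‖ ≤ c :=
  (spatialFamily₃ A B C).norm_env_le hc fun i => h i.1 i.2.1 i.2.2

lemma rep_prodHom₂₃ (π : HilbertRep A) (ρ : HilbertRep B) (τ : HilbertRep C) (x : B ⊗[ℂ] C) :
    rep π ρ τ (prodHom incl₂ incl₃ commute₂₃ x) = rightAmp (tensorRep ρ.hom τ.hom x) := by
  have key : (rep π ρ τ).comp (prodHom incl₂ incl₃ commute₂₃) =
      rightAmp.comp (tensorRep ρ.hom τ.hom) := by
    refine starAlgHom_tensor_ext (D := HilbertTensor π.space (HilbertTensor ρ.space τ.space) →L[ℂ]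
      HilbertTensor π.space (HilbertTensor ρ.space τ.space)) fun b c => ?_
    have h1 : prodHom (incl₂ (A := A)) incl₃ commute₂₃ (b ⊗ₜ c) = tmul 1 b c := by
      refine (prodHom_tmul (D := MinTensor₃ A B C) _ _ commute₂₃ b c).trans ?_
      rw [← incl_mul_incl_mul_incl, map_one, one_mul]
    refine (congrArg (rep π ρ τ) h1).trans ((rep_tmul π ρ τ 1 b c).trans ?_)
    refine Eq.trans ?_ (congrArg rightAmp (tensorRep_tmul ρ.hom τ.hom b c).symm)
    rw [map_one]; rfl
  exact DFunLike.congr_fun key x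

lemma norm_rightAmp_le {H K : Type u} [NormedAddCommGroup H] [InnerProductSpace ℂ H]
    [CompleteSpace H] [NormedAddCommGroup K] [InnerProductSpace ℂ K] [CompleteSpace K]
    (T : K →L[ℂ] K) : ‖rightAmp (H := H) T‖ ≤ ‖T‖ :=
  NonUnitalStarAlgHom.norm_apply_le (rightAmp (H := H) (K := K)) T

lemma norm_leftAmp_le {H K : Type u} [NormedAddCommGroup H] [InnerProductSpace ℂ H]
    [CompleteSpace H] [NormedAddCommGroup K] [InnerProductSpace ℂ K] [CompleteSpace K]
    (T : H →L[ℂ] H) : ‖leftAmp (K := K) T‖ ≤ ‖T‖ :=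
  NonUnitalStarAlgHom.norm_apply_le (leftAmp (H := H) (K := K)) T

/-- `b ⊗ c ↦ 1 ⊗ b ⊗ c`. -/
def incl₂₃ : MinTensor B C →⋆ₐ[ℂ] MinTensor₃ A B C :=
  MinTensor.lift incl₂ incl₃ commute₂₃ fun x =>
    norm_le ((spatialFamily B C).seminorm_nonneg x) fun π ρ τ => by
      rw [rep_prodHom₂₃]
      exact (norm_rightAmp_le _).trans (MinTensor.norm_tensorRep_le x ρ τ)

lemma incl₂₃_tmul (b : B) (c : C) :
    incl₂₃ (A := A) (MinTensor.tmul b c) = incl₂ b * incl₃ c :=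
  MinTensor.lift_tmul _ _ _ _ b c

lemma rep_incl₂₃ (π : HilbertRep A) (ρ : HilbertRep B) (τ : HilbertRep C) (y : MinTensor B C) :
    rep π ρ τ (incl₂₃ y) = rightAmp (MinTensor.rep ρ τ y) := by
  have key : (rep π ρ τ).comp incl₂₃ = rightAmp.comp (MinTensor.rep ρ τ) := by
    refine MinTensor.hom_ext (C := HilbertTensor π.space (HilbertTensor ρ.space τ.space) →L[ℂ]
      HilbertTensor π.space (HilbertTensor ρ.space τ.space)) fun b c => ?_
    have h1 : incl₂₃ (A := A) (MinTensor.tmul b c) = tmul 1 b c := by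
      rw [incl₂₃_tmul, ← incl_mul_incl_mul_incl, map_one, one_mul]
    refine (congrArg (rep π ρ τ) h1).trans ((rep_tmul π ρ τ 1 b c).trans ?_)
    refine Eq.trans ?_ (congrArg rightAmp (MinTensor.rep_tmul ρ τ b c).symm)
    rw [map_one]; rfl
  exact DFunLike.congr_fun key y

lemma commute_incl₁_incl₂₃ (a : A) (y : MinTensor B C) :
    Commute (incl₁ (B := B) (C := C) a) (incl₂₃ y) := by
  refine MinTensor.induction_on (p := fun y => Commute (incl₁ (B := B) (C := C) a) (incl₂₃ y)) y
    (isClosed_eq (continuous_const.mul (MinTensor.continuous_starAlgHom _))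
      ((MinTensor.continuous_starAlgHom _).mul continuous_const)) fun x => ?_
  induction x with
  | zero => rw [map_zero, map_zero]; exact Commute.zero_right _
  | add x y hx hy => rw [map_add, map_add]; exact hx.add_right hy
  | tmul b c =>
    change Commute _ (incl₂₃ (MinTensor.tmul b c))
    rw [incl₂₃_tmul]
    exact (commute₁₂ a b).mul_right (commute₁₃ a c)

lemma rep_assocRight (π : HilbertRep A) (ρ : HilbertRep B) (τ : HilbertRep C)
    (x : A ⊗[ℂ] MinTensor B C) :
    rep π ρ τ (prodHom incl₁ incl₂₃ commute_incl₁_incl₂₃ x) =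
      tensorRep π.hom (MinTensor.rep ρ τ) x := by
  induction x with
  | zero => simp only [map_zero]
  | add x y hx hy => simp only [map_add, hx, hy]
  | tmul a y =>
    refine (congrArg (rep π ρ τ) (prodHom_tmul (D := MinTensor₃ A B C) _ _
      commute_incl₁_incl₂₃ a y)).trans ?_
    rw [map_mul, rep_incl₁, rep_incl₂₃]
    refine Eq.trans ?_ (tensorRep_tmul π.hom (MinTensor.rep ρ τ) a y).symm
    change opTensor (π.hom a) 1 * opTensor 1 (MinTensor.rep ρ τ y) = _
    rw [← opTensor_mul, one_mul, mul_one]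

lemma assocRight_bound (x : A ⊗[ℂ] MinTensor B C) :
    ‖prodHom (D := MinTensor₃ A B C) incl₁ incl₂₃ commute_incl₁_incl₂₃ x‖ ≤
      (spatialFamily A (MinTensor B C)).seminorm x := by
  refine norm_le ((spatialFamily A (MinTensor B C)).seminorm_nonneg x) fun π ρ τ => ?_
  rw [rep_assocRight]
  exact MinTensor.norm_tensorRep_le x π ⟨_, MinTensor.rep ρ τ⟩

/-- The canonical map `A ⊗_min (B ⊗_min C) → A ⊗_min B ⊗_min C`, `a ⊗ (b ⊗ c) ↦ a ⊗ b ⊗ c`. -/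
def assocRight (A B C : Type u) [CStarAlgebra A] [CStarAlgebra B] [CStarAlgebra C] :
    MinTensor A (MinTensor B C) →⋆ₐ[ℂ] MinTensor₃ A B C :=
  MinTensor.lift incl₁ incl₂₃ commute_incl₁_incl₂₃ assocRight_bound

lemma assocRight_tmul (a : A) (b : B) (c : C) :
    assocRight A B C (MinTensor.tmul a (MinTensor.tmul b c)) = tmul a b c := by
  refine (MinTensor.lift_tmul _ _ _ _ a _).trans ?_
  rw [incl₂₃_tmul, incl_mul_incl_mul_incl]

end MinTensor₃

section Associator

variable (H K L : Type u) [NormedAddCommGroup H] [InnerProductSpace ℂ H]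
  [NormedAddCommGroup K] [InnerProductSpace ℂ K] [NormedAddCommGroup L] [InnerProductSpace ℂ L]

/-- `(H ⊗ K) ⊗ L` inside the Hilbert space tensor product bracketed to the left. -/
def embLeft : (H ⊗[ℂ] K) ⊗[ℂ] L →ₗᵢ[ℂ] HilbertTensor (HilbertTensor H K) L :=
  (HilbertTensor.of _ _).comp
    (TensorProduct.mapIsometry (HilbertTensor.of H K) LinearIsometry.id)

/-- `(H ⊗ K) ⊗ L` inside the Hilbert space tensor product bracketed to the right. -/
def embRight : (H ⊗[ℂ] K) ⊗[ℂ] L →ₗᵢ[ℂ] HilbertTensor H (HilbertTensor K L) :=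
  ((HilbertTensor.of _ _).comp
    (TensorProduct.mapIsometry LinearIsometry.id (HilbertTensor.of K L))).comp
    (TensorProduct.assocIsometry ℂ H K L).toLinearIsometry

variable {H K L}

lemma embLeft_tmul (h : H) (k : K) (l : L) :
    embLeft H K L ((h ⊗ₜ k) ⊗ₜ l) =
      HilbertTensor.of _ _ (HilbertTensor.of H K (h ⊗ₜ k) ⊗ₜ l) := rfl

lemma embRight_tmul (h : H) (k : K) (l : L) :
    embRight H K L ((h ⊗ₜ k) ⊗ₜ l) =
      HilbertTensor.of _ _ (h ⊗ₜ HilbertTensor.of K L (k ⊗ₜ l)) := rfl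

lemma embRight_assoc_symm (h : H) (z : K ⊗[ℂ] L) :
    embRight H K L ((TensorProduct.assoc ℂ H K L).symm (h ⊗ₜ z)) =
      HilbertTensor.of _ _ (h ⊗ₜ HilbertTensor.of K L z) := by
  induction z with
  | zero =>
    have h1 : embRight H K L 0 = 0 := (embRight H K L).toLinearMap.map_zero
    have h2 : HilbertTensor.of K L 0 = 0 := (HilbertTensor.of K L).toLinearMap.map_zero
    rw [TensorProduct.tmul_zero, map_zero, h1, h2, TensorProduct.tmul_zero, map_zero]
  | add x y hx hy => simp only [map_add, TensorProduct.tmul_add, hx, hy]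
  | tmul k l => exact embRight_tmul h k l

lemma denseRange_embRight : DenseRange (embRight H K L) := by
  let R : Submodule ℂ (HilbertTensor H (HilbertTensor K L)) :=
    (LinearMap.range (embRight H K L).toLinearMap).topologicalClosure
  have hR : ∀ x, embRight H K L x ∈ R := fun x =>
    Submodule.le_topologicalClosure _ ⟨x, rfl⟩
  have hc : IsClosed (R : Set (HilbertTensor H (HilbertTensor K L))) :=
    Submodule.isClosed_topologicalClosure _
  have h1 : ∀ (h : H) (w : HilbertTensor K L), HilbertTensor.of _ _ (h ⊗ₜ[ℂ] w) ∈ R := by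
    intro h w
    have hcont : Continuous fun w : HilbertTensor K L =>
        HilbertTensor.of H (HilbertTensor K L) (h ⊗ₜ[ℂ] w) :=
      (HilbertTensor.of _ _).continuous.comp
        (TensorProduct.continuous_tmul.comp (Continuous.prodMk_right h))
    refine HilbertTensor.denseRange_of.induction_on w (hc.preimage hcont) fun z => ?_
    have h2 := hR ((TensorProduct.assoc ℂ H K L).symm (h ⊗ₜ z))
    rw [embRight_assoc_symm] at h2
    exact h2
  intro w
  have h3 : w ∈ R := by
    refine HilbertTensor.denseRange_of.induction_on w hc fun x => ?_
    induction x with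
    | zero => rw [map_zero]; exact R.zero_mem
    | add x y hx hy => rw [map_add]; exact R.add_mem hx hy
    | tmul h w => exact h1 h w
  exact h3

/-- The canonical isometry `H ⊗ (K ⊗ L) → (H ⊗ K) ⊗ L` of Hilbert spaces. -/
def hilbertAssoc : HilbertTensor H (HilbertTensor K L) →L[ℂ]
    HilbertTensor (HilbertTensor H K) L :=
  (embLeft H K L).toContinuousLinearMap.extend (embRight H K L).toContinuousLinearMap

lemma hilbertAssoc_emb (x : (H ⊗[ℂ] K) ⊗[ℂ] L) :
    hilbertAssoc (embRight H K L x) = embLeft H K L x :=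
  ContinuousLinearMap.extend_eq (f := (embLeft H K L).toContinuousLinearMap)
    (e := (embRight H K L).toContinuousLinearMap) denseRange_embRight
    (embRight H K L).isometry.isUniformInducing x

lemma norm_hilbertAssoc (x : HilbertTensor H (HilbertTensor K L)) :
    ‖hilbertAssoc x‖ = ‖x‖ := by
  refine denseRange_embRight.induction_on x (isClosed_eq
    (hilbertAssoc.continuous.norm) continuous_norm) fun y => ?_
  rw [hilbertAssoc_emb, LinearIsometry.norm_map, LinearIsometry.norm_map]

lemma hilbertAssoc_opTensor (S : H →L[ℂ] H) (T : K →L[ℂ] K) (U : L →L[ℂ] L) :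
    hilbertAssoc ∘L opTensor S (opTensor T U) = opTensor (opTensor S T) U ∘L hilbertAssoc := by
  ext x
  refine denseRange_embRight.induction_on x (isClosed_eq
    (hilbertAssoc ∘L opTensor S (opTensor T U)).continuous
    (opTensor (opTensor S T) U ∘L hilbertAssoc).continuous) fun y => ?_
  rw [ContinuousLinearMap.comp_apply, ContinuousLinearMap.comp_apply, hilbertAssoc_emb]
  have hz : hilbertAssoc (opTensor S (opTensor T U) (embRight H K L 0)) =
      opTensor (opTensor S T) U (embLeft H K L 0) := by
    have h1 : embRight H K L 0 = 0 := (embRight H K L).toLinearMap.map_zero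
    have h2 : embLeft H K L 0 = 0 := (embLeft H K L).toLinearMap.map_zero
    rw [h1, h2, map_zero, map_zero, map_zero]
  induction y with
  | zero => exact hz
  | add y z hy hz => simp only [map_add, hy, hz]
  | tmul x l =>
    induction x with
    | zero => rw [TensorProduct.zero_tmul]; exact hz
    | add y z hy hz => simp only [TensorProduct.add_tmul, map_add, hy, hz]
    | tmul h k =>
      rw [embRight_tmul, embLeft_tmul, opTensor_of, opTensor_of, TensorProduct.mapL_tmul,
        TensorProduct.mapL_tmul, opTensor_of, opTensor_of, TensorProduct.mapL_tmul,
        TensorProduct.mapL_tmul, ← embRight_tmul, ← embLeft_tmul, hilbertAssoc_emb]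

lemma norm_le_of_hilbertAssoc
    {T : HilbertTensor H (HilbertTensor K L) →L[ℂ] HilbertTensor H (HilbertTensor K L)}
    {T' : HilbertTensor (HilbertTensor H K) L →L[ℂ] HilbertTensor (HilbertTensor H K) L}
    (h : hilbertAssoc ∘L T = T' ∘L hilbertAssoc) : ‖T‖ ≤ ‖T'‖ := by
  refine T.opNorm_le_bound (norm_nonneg T') fun x => ?_
  rw [← norm_hilbertAssoc (T x), ← norm_hilbertAssoc x, ← ContinuousLinearMap.comp_apply, h]
  exact T'.le_opNorm _

end Associator

namespace MinTensor₃

variable {A B C : Type u} [CStarAlgebra A] [CStarAlgebra B] [CStarAlgebra C]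

lemma incl₁_mul_incl₂ (a : A) (b : B) :
    incl₁ a * incl₂ b = tmul a b (1 : C) := by
  rw [← incl_mul_incl_mul_incl, map_one, mul_one]

lemma rep_prodHom₁₂ (π : HilbertRep A) (ρ : HilbertRep B) (τ : HilbertRep C) (x : A ⊗[ℂ] B) :
    hilbertAssoc ∘L rep π ρ τ (prodHom incl₁ incl₂ commute₁₂ x) =
      opTensor (tensorRep π.hom ρ.hom x) 1 ∘L hilbertAssoc := by
  induction x with
  | zero =>
    rw [map_zero, map_zero, map_zero, ContinuousLinearMap.comp_zero]
    exact (congrArg (· ∘L hilbertAssoc) (map_zero leftAmpAlg)).symm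
  | add x y hx hy =>
    rw [map_add, map_add, map_add, ContinuousLinearMap.comp_add, hx, hy,
      ← ContinuousLinearMap.add_comp]
    exact (congrArg (· ∘L hilbertAssoc) (map_add leftAmpAlg _ _)).symm
  | tmul a b =>
    have h1 : prodHom incl₁ incl₂ commute₁₂ (a ⊗ₜ b) = tmul a b (1 : C) :=
      (prodHom_tmul (D := MinTensor₃ A B C) _ _ commute₁₂ a b).trans (incl₁_mul_incl₂ a b)
    rw [h1, rep_tmul, map_one, hilbertAssoc_opTensor, tensorRep_tmul]

/-- `a ⊗ b ↦ a ⊗ b ⊗ 1`. -/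
def incl₁₂ : MinTensor A B →⋆ₐ[ℂ] MinTensor₃ A B C :=
  MinTensor.lift incl₁ incl₂ commute₁₂ fun x =>
    norm_le ((spatialFamily A B).seminorm_nonneg x) fun π ρ τ =>
      (norm_le_of_hilbertAssoc (rep_prodHom₁₂ π ρ τ x)).trans
        ((norm_leftAmp_le _).trans (MinTensor.norm_tensorRep_le x π ρ))

lemma incl₁₂_tmul (a : A) (b : B) :
    incl₁₂ (C := C) (MinTensor.tmul a b) = incl₁ a * incl₂ b :=
  MinTensor.lift_tmul _ _ _ _ a b

lemma rep_incl₁₂ (π : HilbertRep A) (ρ : HilbertRep B) (τ : HilbertRep C) (y : MinTensor A B) :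
    hilbertAssoc ∘L rep π ρ τ (incl₁₂ y) = opTensor (MinTensor.rep π ρ y) 1 ∘L hilbertAssoc := by
  have c1 : Continuous fun y : MinTensor A B => hilbertAssoc ∘L rep π ρ τ (incl₁₂ y) :=
    continuous_const.clm_comp ((MinTensor.continuous_starAlgHom (rep π ρ τ)).comp
      (MinTensor.continuous_starAlgHom incl₁₂))
  have c2 : Continuous fun y : MinTensor A B =>
      opTensor (MinTensor.rep π ρ y) (1 : τ.space →L[ℂ] τ.space) ∘L hilbertAssoc :=
    ((MinTensor.continuous_starAlgHom leftAmp).comp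
      (MinTensor.continuous_starAlgHom (MinTensor.rep π ρ))).clm_comp continuous_const
  refine MinTensor.induction_on (p := fun y => hilbertAssoc ∘L rep π ρ τ (incl₁₂ y) =
    opTensor (MinTensor.rep π ρ y) 1 ∘L hilbertAssoc) y (isClosed_eq c1 c2) fun x => ?_
  have h1 : incl₁₂ (C := C) (MinTensor.ofAlg A B x) = prodHom incl₁ incl₂ commute₁₂ x :=
    RepFamily.extend_toEnv _ _ _ _
  rw [h1, rep_prodHom₁₂, MinTensor.rep_ofAlg]

lemma commute_incl₁₂_incl₃ (y : MinTensor A B) (c : C) :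
    Commute (incl₁₂ y) (incl₃ (A := A) (B := B) c) := by
  refine MinTensor.induction_on (p := fun y => Commute (incl₁₂ y) (incl₃ (A := A) (B := B) c)) y
    (isClosed_eq ((MinTensor.continuous_starAlgHom _).mul continuous_const)
      (continuous_const.mul (MinTensor.continuous_starAlgHom _))) fun x => ?_
  induction x with
  | zero => rw [map_zero, map_zero]; exact Commute.zero_left _
  | add x y hx hy => rw [map_add, map_add]; exact hx.add_left hy
  | tmul a b =>
    change Commute (incl₁₂ (MinTensor.tmul a b)) _
    rw [incl₁₂_tmul]
    exact (commute₁₃ a c).mul_left (commute₂₃ b c)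

lemma rep_assocLeft (π : HilbertRep A) (ρ : HilbertRep B) (τ : HilbertRep C)
    (x : MinTensor A B ⊗[ℂ] C) :
    hilbertAssoc ∘L rep π ρ τ (prodHom incl₁₂ incl₃ commute_incl₁₂_incl₃ x) =
      tensorRep (MinTensor.rep π ρ) τ.hom x ∘L hilbertAssoc := by
  induction x with
  | zero => simp only [map_zero, ContinuousLinearMap.comp_zero, ContinuousLinearMap.zero_comp]
  | add x y hx hy =>
    simp only [map_add, ContinuousLinearMap.comp_add, ContinuousLinearMap.add_comp, hx, hy]
  | tmul y c =>
    have h1 : prodHom (incl₁₂ (A := A) (B := B)) incl₃ commute_incl₁₂_incl₃ (y ⊗ₜ c) =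
        incl₁₂ y * incl₃ c :=
      prodHom_tmul (D := MinTensor₃ A B C) _ _ commute_incl₁₂_incl₃ y c
    have h2 : rep π ρ τ (incl₃ c) = opTensor 1 (opTensor 1 (τ.hom c)) := by
      refine (rep_tmul π ρ τ 1 1 c).trans ?_
      rw [map_one, map_one]
    rw [h1, map_mul, h2, tensorRep_tmul, ContinuousLinearMap.mul_def,
      ← ContinuousLinearMap.comp_assoc, rep_incl₁₂, ContinuousLinearMap.comp_assoc,
      hilbertAssoc_opTensor, ← ContinuousLinearMap.comp_assoc, ← ContinuousLinearMap.mul_def,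
      ← opTensor_mul, opTensor_one, mul_one, one_mul]

lemma assocLeft_bound (x : MinTensor A B ⊗[ℂ] C) :
    ‖prodHom (D := MinTensor₃ A B C) incl₁₂ incl₃ commute_incl₁₂_incl₃ x‖ ≤
      (spatialFamily (MinTensor A B) C).seminorm x := by
  refine norm_le ((spatialFamily (MinTensor A B) C).seminorm_nonneg x) fun π ρ τ => ?_
  exact (norm_le_of_hilbertAssoc (rep_assocLeft π ρ τ x)).trans
    (MinTensor.norm_tensorRep_le x ⟨_, MinTensor.rep π ρ⟩ τ)

/-- The canonical map `(A ⊗_min B) ⊗_min C → A ⊗_min B ⊗_min C`, `(a ⊗ b) ⊗ c ↦ a ⊗ b ⊗ c`. -/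
def assocLeft (A B C : Type u) [CStarAlgebra A] [CStarAlgebra B] [CStarAlgebra C] :
    MinTensor (MinTensor A B) C →⋆ₐ[ℂ] MinTensor₃ A B C :=
  MinTensor.lift incl₁₂ incl₃ commute_incl₁₂_incl₃ assocLeft_bound

lemma assocLeft_tmul (a : A) (b : B) (c : C) :
    assocLeft A B C (MinTensor.tmul (MinTensor.tmul a b) c) = tmul a b c := by
  refine (MinTensor.lift_tmul _ _ _ _ _ c).trans ?_
  rw [incl₁₂_tmul, mul_assoc, incl_mul_incl_mul_incl]

end MinTensor₃

/-! ### The universal C⋆-algebras -/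

/-- The free complex `*`-algebra on self-adjoint generators indexed by `X`: non-commutative
polynomials, with the conjugate-linear involution that reverses words. -/
def FreeStarAlgebra (X : Type u) : Type u := MonoidAlgebra ℂ (FreeMonoid X)

namespace FreeStarAlgebra

variable {X : Type u}

instance : Ring (FreeStarAlgebra X) := inferInstanceAs (Ring (MonoidAlgebra ℂ (FreeMonoid X)))
instance : Algebra ℂ (FreeStarAlgebra X) :=
  inferInstanceAs (Algebra ℂ (MonoidAlgebra ℂ (FreeMonoid X)))

/-- The generator indexed by `x`. -/
def gen (x : X) : FreeStarAlgebra X := MonoidAlgebra.of ℂ (FreeMonoid X) (FreeMonoid.of x)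

lemma ringHom_ext {R : Type*} [Ring R] {f g : FreeStarAlgebra X →+* R}
    (h : ∀ c : ℂ, f (algebraMap ℂ _ c) = g (algebraMap ℂ _ c)) (h' : ∀ x, f (gen x) = g (gen x)) :
    f = g := by
  refine MonoidAlgebra.ringHom_ext' (R := ℂ) (M := FreeMonoid X) (RingHom.ext h) ?_
  exact FreeMonoid.hom_eq h'

lemma starHom_commute (c : ℂ) (w : FreeMonoid X) :
    Commute ((algebraMap ℂ (FreeStarAlgebra X)ᵐᵒᵖ).comp (starRingEnd ℂ) c)
      (FreeMonoid.lift (fun x => MulOpposite.op (gen x)) w) := by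
  rw [RingHom.comp_apply]
  exact Algebra.commutes (starRingEnd ℂ c) _

/-- The involution, as a ring homomorphism to the opposite algebra. -/
def starHom : FreeStarAlgebra X →+* (FreeStarAlgebra X)ᵐᵒᵖ :=
  MonoidAlgebra.liftNCRingHom (k := ℂ) (G := FreeMonoid X)
    ((algebraMap ℂ (FreeStarAlgebra X)ᵐᵒᵖ).comp (starRingEnd ℂ))
    (FreeMonoid.lift fun x => MulOpposite.op (gen x))
    starHom_commute

lemma starHom_algebraMap (c : ℂ) : starHom (algebraMap ℂ (FreeStarAlgebra X) c) =
    MulOpposite.op (algebraMap ℂ _ (starRingEnd ℂ c)) := by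
  refine (MonoidAlgebra.liftNC_single (k := ℂ) (G := FreeMonoid X) _ _ 1 c).trans ?_
  simp

lemma starHom_gen (x : X) : starHom (gen x) = MulOpposite.op (gen x) := by
  refine (MonoidAlgebra.liftNC_single (k := ℂ) (G := FreeMonoid X) _ _ (FreeMonoid.of x) 1).trans ?_
  simp

instance : Star (FreeStarAlgebra X) := ⟨fun a => (starHom a).unop⟩

lemma star_def (a : FreeStarAlgebra X) : star a = (starHom a).unop := rfl

lemma star_gen (x : X) : star (gen x) = gen x := by rw [star_def, starHom_gen]; rfl

lemma star_algebraMap' (c : ℂ) : star (algebraMap ℂ (FreeStarAlgebra X) c) =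
    algebraMap ℂ _ (starRingEnd ℂ c) := by rw [star_def, starHom_algebraMap]; rfl

instance : StarRing (FreeStarAlgebra X) where
  star_mul a b := by simp only [star_def, map_mul, MulOpposite.unop_mul]
  star_add a b := by simp only [star_def, map_add, MulOpposite.unop_add]
  star_involutive a := by
    let f : FreeStarAlgebra X →+* FreeStarAlgebra X :=
      { toFun := fun a => star (star a)
        map_one' := by simp only [star_def, map_one, MulOpposite.unop_one]
        map_zero' := by simp only [star_def, map_zero, MulOpposite.unop_zero]
        map_mul' := fun a b => by simp only [star_def, map_mul, MulOpposite.unop_mul]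
        map_add' := fun a b => by simp only [star_def, map_add, MulOpposite.unop_add] }
    have h : f = RingHom.id _ := by
      refine ringHom_ext (fun c => ?_) fun x => ?_
      · change star (star (algebraMap ℂ (FreeStarAlgebra X) c)) = algebraMap ℂ _ c
        rw [star_algebraMap', star_algebraMap', starRingEnd_self_apply]
      · change star (star (gen x)) = gen x
        rw [star_gen, star_gen]
    exact DFunLike.congr_fun h a

instance : StarModule ℂ (FreeStarAlgebra X) where
  star_smul c a := by
    rw [Algebra.smul_def, Algebra.smul_def, star_mul, star_algebraMap', ← Algebra.commutes]
    rfl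

/-- The `*`-homomorphism that sends the generators to given self-adjoint elements. -/
def lift {D : Type u} [CStarAlgebra D] (q : X → D) (hq : ∀ x, star (q x) = q x) :
    FreeStarAlgebra X →⋆ₐ[ℂ] D :=
  let φ : FreeStarAlgebra X →ₐ[ℂ] D := MonoidAlgebra.lift ℂ D (FreeMonoid X) (FreeMonoid.lift q)
  have hφ : ∀ x, φ (gen x) = q x := fun x => by
    refine (MonoidAlgebra.lift_of (R := ℂ) (FreeMonoid.lift q) (FreeMonoid.of x)).trans ?_
    simp
  { φ with
    map_star' := fun a => by
      change φ (star a) = star (φ a)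
      let f : FreeStarAlgebra X →+* D :=
        { toFun := fun a => star (φ (star a))
          map_one' := by rw [star_one, map_one, star_one]
          map_zero' := by rw [star_zero, map_zero, star_zero]
          map_mul' := fun a b => by rw [star_mul, map_mul, star_mul]
          map_add' := fun a b => by rw [star_add, map_add, star_add] }
      have h : f = φ := by
        refine ringHom_ext (fun c => ?_) fun x => ?_
        · change star (φ (star (algebraMap ℂ (FreeStarAlgebra X) c))) = φ (algebraMap ℂ _ c)
          rw [star_algebraMap', AlgHom.commutes, AlgHom.commutes, ← algebraMap_star_comm]
          simp
        · change star (φ (star (gen x))) = φ (gen x)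
          rw [star_gen, hφ, hq]
      have h2 : star (φ (star a)) = φ a := DFunLike.congr_fun h a
      rw [← h2, star_star] }

@[simp]
lemma lift_gen {D : Type u} [CStarAlgebra D] (q : X → D) (hq : ∀ x, star (q x) = q x) (x : X) :
    lift q hq (gen x) = q x := by
  refine (MonoidAlgebra.lift_of (R := ℂ) (FreeMonoid.lift q) (FreeMonoid.of x)).trans ?_
  simp

lemma starAlgHom_ext {D : Type u} [Ring D] [StarRing D] [Algebra ℂ D]
    {φ ψ : FreeStarAlgebra X →⋆ₐ[ℂ] D} (h : ∀ x, φ (gen x) = ψ (gen x)) : φ = ψ := by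
  have h2 : (φ : FreeStarAlgebra X →+* D) = (ψ : FreeStarAlgebra X →+* D) :=
    ringHom_ext (fun c => (AlgHomClass.commutes φ c).trans (AlgHomClass.commutes ψ c).symm) h
  ext a
  exact DFunLike.congr_fun h2 a

@[elab_as_elim]
lemma induction_on {p : FreeStarAlgebra X → Prop} (a : FreeStarAlgebra X) (h1 : p 1)
    (hg : ∀ x a, p a → p (gen x * a)) (hadd : ∀ a b, p a → p b → p (a + b))
    (hsmul : ∀ (c : ℂ) a, p a → p (c • a)) : p a := by
  refine MonoidAlgebra.induction_on (R := ℂ) (M := FreeMonoid X) (motive := p) a (fun w => ?_) hadd hsmul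
  induction w using FreeMonoid.recOn with
  | one => rw [map_one]; exact h1
  | of_mul x w hw => rw [map_mul]; exact hg x _ hw

/-- Elements are uniformly bounded in all representations by generators of norm at most one. -/
lemma exists_bound (a : FreeStarAlgebra X) : ∃ c : ℝ, ∀ (D : Type u) (_ : CStarAlgebra D)
    (φ : FreeStarAlgebra X →⋆ₐ[ℂ] D), (∀ x, ‖φ (gen x)‖ ≤ 1) → ‖φ a‖ ≤ c := by
  induction a using induction_on with
  | h1 =>
    refine ⟨1, fun D _ φ _ => ?_⟩
    rw [map_one]
    have h : ‖(1 : D)‖ * ‖(1 : D)‖ = ‖(1 : D)‖ := by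
      rw [← CStarRing.norm_star_mul_self, star_one, one_mul]
    nlinarith [norm_nonneg (1 : D)]
  | hg x a ha =>
    obtain ⟨c, hc⟩ := ha
    refine ⟨c, fun D i φ hφ => ?_⟩
    rw [map_mul]
    refine (norm_mul_le _ _).trans ?_
    have := mul_le_mul (hφ x) (hc D i φ hφ) (norm_nonneg _) zero_le_one
    rwa [one_mul] at this
  | hadd a b ha hb =>
    obtain ⟨c, hc⟩ := ha
    obtain ⟨d, hd⟩ := hb
    refine ⟨c + d, fun D i φ hφ => ?_⟩
    rw [map_add]
    exact (norm_add_le _ _).trans (add_le_add (hc D i φ hφ) (hd D i φ hφ))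
  | hsmul z a ha =>
    obtain ⟨c, hc⟩ := ha
    refine ⟨‖z‖ * c, fun D i φ hφ => ?_⟩
    rw [map_smul, norm_smul]
    exact mul_le_mul_of_nonneg_left (hc D i φ hφ) (norm_nonneg _)

end FreeStarAlgebra

/-! ### Compact quantum groups and their coactions -/

/-- A compact quantum group: a unital C⋆-algebra `alg` with a coassociative comultiplication
`alg → alg ⊗_min alg` that has the cancellation (density) property. -/
structure CompactQuantumGroup : Type (u + 1) where
  alg : Type u
  [cstar : CStarAlgebra alg]
  comul : alg →⋆ₐ[ℂ] MinTensor alg alg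
  coassoc : (MinTensor₃.assocRight alg alg alg).comp
      ((MinTensor.map (StarAlgHom.id ℂ alg) comul).comp comul) =
    (MinTensor₃.assocLeft alg alg alg).comp
      ((MinTensor.map comul (StarAlgHom.id ℂ alg)).comp comul)
  dense_right : Dense (Submodule.span ℂ
    {x : MinTensor alg alg | ∃ a b, x = comul a * MinTensor.tmul 1 b} : Set (MinTensor alg alg))
  dense_left : Dense (Submodule.span ℂ
    {x : MinTensor alg alg | ∃ a b, x = comul a * MinTensor.tmul b 1} : Set (MinTensor alg alg))

attribute [instance] CompactQuantumGroup.cstar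

/-- A (C⋆-)coaction of the compact quantum group `G` on the unital C⋆-algebra `A`. -/
structure Coaction (G : CompactQuantumGroup.{u}) (A : Type u) [CStarAlgebra A] where
  hom : A →⋆ₐ[ℂ] MinTensor A G.alg
  coaction : (MinTensor₃.assocRight A G.alg G.alg).comp
      ((MinTensor.map (StarAlgHom.id ℂ A) G.comul).comp hom) =
    (MinTensor₃.assocLeft A G.alg G.alg).comp
      ((MinTensor.map hom (StarAlgHom.id ℂ G.alg)).comp hom)
  dense : Dense (Submodule.span ℂ
    {x : MinTensor A G.alg | ∃ a b, x = hom a * MinTensor.tmul 1 b} : Set (MinTensor A G.alg))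

/-! ### The quantum groups `G_k^+(Γ)` -/

/-- The tuple `p` of vertices is a path in `Γ`: consecutive vertices are adjacent. -/
def IsPath {V : Type u} (Γ : SimpleGraph V) {n : ℕ} (p : Fin (n + 1) → V) : Prop :=
  ∀ a : Fin n, Γ.Adj (p a.castSucc) (p a.succ)

instance {V : Type u} (Γ : SimpleGraph V) [DecidableRel Γ.Adj] {n : ℕ} (p : Fin (n + 1) → V) :
    Decidable (IsPath Γ p) := by unfold IsPath; infer_instance

/-- The product `q_{i₁j₁} q_{i₂j₂} ⋯ q_{iₘjₘ}`, in this order. -/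
def pathProd {V : Type u} {D : Type*} [Monoid D] (q : V → V → D) {m : ℕ} (i j : Fin m → V) : D :=
  (List.ofFn fun a => q (i a) (j a)).prod

/-- The product `q_{iₘjₘ} ⋯ q_{i₂j₂} q_{i₁j₁}` in the opposite order. -/
def pathProdRev {V : Type u} {D : Type*} [Monoid D] (q : V → V → D) {m : ℕ} (i j : Fin m → V) : D :=
  (List.ofFn fun a => q (i a) (j a)).reverse.prod

section Relations

variable {V : Type u} [Fintype V] [DecidableEq V] (k : ℕ) (Γ : SimpleGraph V) [DecidableRel Γ.Adj]

/-- The defining relations of `C(G_k^+(Γ))`: the relations of the quantum automorphism group of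
`Γ` (a magic unitary that commutes with the adjacency matrix), together with
`q_{i₁j₁} ⋯ q_{iₘjₘ} = q_{iₘjₘ} ⋯ q_{i₁j₁}` for all paths `(i₁, …, iₘ)` and `(j₁, …, jₘ)` with at
most `k + 1` vertices. -/
structure QuantumRelations {D : Type*} [Ring D] [StarRing D] (q : V → V → D) : Prop where
  star_eq : ∀ i j, star (q i j) = q i j
  row_sum : ∀ i, ∑ j, q i j = 1
  col_sum : ∀ i, ∑ j, q j i = 1
  row_mul : ∀ i j l, q i j * q i l = if j = l then q i j else 0
  col_mul : ∀ i j l, q j i * q l i = if j = l then q j i else 0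
  adj_comm : Matrix.of q * Γ.adjMatrix D = Γ.adjMatrix D * Matrix.of q
  path_rev : ∀ n ≤ k, ∀ i j : Fin (n + 1) → V, IsPath Γ i → IsPath Γ j →
    pathProd q i j = pathProdRev q i j

lemma map_pathProd {D D' F : Type*} [Monoid D] [Monoid D'] [FunLike F D D'] [MonoidHomClass F D D']
    (φ : F) (q : V → V → D) {m : ℕ} (i j : Fin m → V) :
    φ (pathProd q i j) = pathProd (fun a b => φ (q a b)) i j := by
  rw [pathProd, map_list_prod, List.map_ofFn]; rfl

lemma map_pathProdRev {D D' F : Type*} [Monoid D] [Monoid D'] [FunLike F D D']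
    [MonoidHomClass F D D'] (φ : F) (q : V → V → D) {m : ℕ} (i j : Fin m → V) :
    φ (pathProdRev q i j) = pathProdRev (fun a b => φ (q a b)) i j := by
  rw [pathProdRev, map_list_prod, List.map_reverse, List.map_ofFn]; rfl

lemma map_adj {D D' : Type*} [Ring D] [Ring D'] (φ : D →+* D') (q : V → V → D) :
    (Matrix.of q * Γ.adjMatrix D).map φ = Matrix.of (fun a b => φ (q a b)) * Γ.adjMatrix D' ∧
      (Γ.adjMatrix D * Matrix.of q).map φ = Γ.adjMatrix D' * Matrix.of (fun a b => φ (q a b)) := by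
  have h : (Γ.adjMatrix D).map φ = Γ.adjMatrix D' := by
    ext i j
    simp only [Matrix.map_apply, SimpleGraph.adjMatrix_apply]
    split_ifs
    · exact map_one φ
    · exact map_zero φ
  rw [Matrix.map_mul, Matrix.map_mul, h]
  exact ⟨rfl, rfl⟩

variable {k Γ}

/-- The relations may be checked in a separating family of `*`-homomorphisms. -/
lemma QuantumRelations.of_separating {D : Type u} [CStarAlgebra D] {q : V → V → D}
    {ι : Type*} {E : ι → Type u} [∀ i, CStarAlgebra (E i)] (φ : ∀ i, D →⋆ₐ[ℂ] E i)
    (hφ : ∀ x y, (∀ i, φ i x = φ i y) → x = y)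
    (h : ∀ s, QuantumRelations k Γ fun i j => φ s (q i j)) : QuantumRelations k Γ q where
  star_eq i j := hφ _ _ fun s => by rw [map_star]; exact (h s).star_eq i j
  row_sum i := hφ _ _ fun s => by rw [map_sum, map_one]; exact (h s).row_sum i
  col_sum i := hφ _ _ fun s => by rw [map_sum, map_one]; exact (h s).col_sum i
  row_mul i j l := hφ _ _ fun s => by
    rw [map_mul, (h s).row_mul]; split_ifs
    · rfl
    · rw [map_zero]
  col_mul i j l := hφ _ _ fun s => by
    rw [map_mul, (h s).col_mul]; split_ifs
    · rfl
    · rw [map_zero]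
  adj_comm := by
    ext i j
    refine hφ _ _ fun s => ?_
    have h1 := map_adj Γ (RingHomClass.toRingHom (φ s)) q
    have h2 := h1.1.trans ((h s).adj_comm.trans h1.2.symm)
    exact congrFun (congrFun h2 i) j
  path_rev n hn i j hi hj := hφ _ _ fun s => by
    rw [map_pathProd, map_pathProdRev]
    exact (h s).path_rev n hn i j hi hj

lemma QuantumRelations.map {D D' : Type u} [CStarAlgebra D] [CStarAlgebra D'] {q : V → V → D}
    (h : QuantumRelations k Γ q) (φ : D →⋆ₐ[ℂ] D') :
    QuantumRelations k Γ fun i j => φ (q i j) where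
  star_eq i j := by rw [← map_star, h.star_eq]
  row_sum i := by rw [← map_sum, h.row_sum, map_one]
  col_sum i := by rw [← map_sum, h.col_sum, map_one]
  row_mul i j l := by
    rw [← map_mul, h.row_mul]; split_ifs
    · rfl
    · rw [map_zero]
  col_mul i j l := by
    rw [← map_mul, h.col_mul]; split_ifs
    · rfl
    · rw [map_zero]
  adj_comm := by
    have h1 := map_adj Γ (RingHomClass.toRingHom φ) q
    exact h1.1.symm.trans ((congrArg (fun M => Matrix.map M _) h.adj_comm).trans h1.2)
  path_rev n hn i j hi hj := by
    rw [← map_pathProd, ← map_pathProdRev, h.path_rev n hn i j hi hj]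

lemma QuantumRelations.norm_le_one {D : Type u} [CStarAlgebra D] {q : V → V → D}
    (h : QuantumRelations k Γ q) (i j : V) : ‖q i j‖ ≤ 1 := by
  have h1 : ‖q i j‖ * ‖q i j‖ = ‖q i j‖ := by
    rw [← CStarRing.norm_star_mul_self, h.star_eq, h.row_mul, if_pos rfl]
  nlinarith [norm_nonneg (q i j)]

variable (k Γ)

/-- A family of elements of a C⋆-algebra that satisfies the relations of `C(G_k^+(Γ))`. -/
structure QuantumRep : Type (u + 1) where
  alg : Type u
  [cstar : CStarAlgebra alg]
  q : V → V → alg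
  relations : QuantumRelations k Γ q

attribute [instance] QuantumRep.cstar

variable {k Γ} in
/-- The `*`-homomorphism `q_{ij} ↦ s.q i j` on the free `*`-algebra. -/
def QuantumRep.hom (s : QuantumRep k Γ) : FreeStarAlgebra (V × V) →⋆ₐ[ℂ] s.alg :=
  FreeStarAlgebra.lift (fun x => s.q x.1 x.2) fun x => s.relations.star_eq x.1 x.2

variable {k Γ} in
lemma QuantumRep.hom_gen (s : QuantumRep k Γ) (i j : V) :
    s.hom (FreeStarAlgebra.gen (i, j)) = s.q i j :=
  FreeStarAlgebra.lift_gen (fun x : V × V => s.q x.1 x.2) _ (i, j)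

/-- All `*`-homomorphisms from the free `*`-algebra on self-adjoint generators `q_{ij}` to
C⋆-algebras such that the images of the generators satisfy the relations of `C(G_k^+(Γ))`. -/
def quantumFamily : RepFamily (FreeStarAlgebra (V × V)) where
  Idx := QuantumRep k Γ
  alg s := s.alg
  hom s := s.hom
  bdd a := by
    obtain ⟨c, hc⟩ := FreeStarAlgebra.exists_bound a
    refine ⟨c, ?_⟩
    rintro _ ⟨s, rfl⟩
    refine hc s.alg _ _ fun x => ?_
    rw [QuantumRep.hom_gen]
    exact s.relations.norm_le_one _ _

/-- The C⋆-algebra `C(G_k^+(Γ))`: the universal unital C⋆-algebra with generators `q_{ij}`,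
`i, j ∈ V`, and the relations `QuantumRelations k Γ`. -/
def QuantumAlgebra : Type u := (quantumFamily k Γ).Env

instance : CStarAlgebra (QuantumAlgebra k Γ) :=
  inferInstanceAs (CStarAlgebra (quantumFamily k Γ).Env)

namespace QuantumAlgebra

/-- The generator `q_{ij}` of `C(G_k^+(Γ))`. -/
def q (i j : V) : QuantumAlgebra k Γ := (quantumFamily k Γ).toEnv (FreeStarAlgebra.gen (i, j))

variable {k Γ}

lemma induction_on {p : QuantumAlgebra k Γ → Prop} (x : QuantumAlgebra k Γ)
    (hp : IsClosed {x | p x}) (h : ∀ a, p ((quantumFamily k Γ).toEnv a)) : p x :=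
  RepFamily.env_induction x hp h

/-- The homomorphism that belongs to a family which satisfies the relations. -/
def homOf (s : QuantumRep k Γ) : QuantumAlgebra k Γ →⋆ₐ[ℂ] s.alg := (quantumFamily k Γ).homEnv s

lemma homOf_toEnv (s : QuantumRep k Γ) (a : FreeStarAlgebra (V × V)) :
    homOf s ((quantumFamily k Γ).toEnv a) = s.hom a :=
  (quantumFamily k Γ).homEnv_toEnv s a

lemma homOf_q (s : QuantumRep k Γ) (i j : V) : homOf s (q k Γ i j) = s.q i j :=
  (homOf_toEnv s _).trans (s.hom_gen i j)

lemma norm_le {x : QuantumAlgebra k Γ} {c : ℝ} (hc : 0 ≤ c)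
    (h : ∀ s : QuantumRep k Γ, ‖homOf s x‖ ≤ c) : ‖x‖ ≤ c :=
  (quantumFamily k Γ).norm_env_le hc h

lemma separating (x y : QuantumAlgebra k Γ)
    (h : ∀ s : QuantumRep k Γ, homOf s x = homOf s y) : x = y := by
  have h1 : ‖x - y‖ ≤ 0 := norm_le le_rfl fun s => by
    rw [map_sub, h s, sub_self, norm_zero]
  exact sub_eq_zero.mp (norm_le_zero_iff.mp h1)

variable (k Γ) in
/-- The generators satisfy the relations. -/
theorem relations : QuantumRelations k Γ (q k Γ) := by
  refine QuantumRelations.of_separating (D := QuantumAlgebra k Γ) (E := fun s : QuantumRep k Γ => s.alg)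
    homOf separating fun s => ?_
  have h : (fun i j => homOf s (q k Γ i j)) = s.q := by
    funext i j; exact homOf_q s i j
  exact h ▸ s.relations

/-- The universal property: elements that satisfy the relations define a `*`-homomorphism. -/
def desc {D : Type u} [CStarAlgebra D] (r : V → V → D) (hr : QuantumRelations k Γ r) :
    QuantumAlgebra k Γ →⋆ₐ[ℂ] D :=
  homOf ⟨D, r, hr⟩

@[simp]
lemma desc_q {D : Type u} [CStarAlgebra D] (r : V → V → D) (hr : QuantumRelations k Γ r) (i j : V) :
    desc r hr (q k Γ i j) = r i j := homOf_q ⟨D, r, hr⟩ i j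

lemma hom_ext {D : Type u} [CStarAlgebra D] {φ ψ : QuantumAlgebra k Γ →⋆ₐ[ℂ] D}
    (h : ∀ i j, φ (q k Γ i j) = ψ (q k Γ i j)) : φ = ψ := by
  ext x
  refine induction_on x (isClosed_eq (MinTensor.continuous_starAlgHom φ)
    (MinTensor.continuous_starAlgHom ψ)) fun a => ?_
  have h2 : φ.comp (quantumFamily k Γ).toEnv = ψ.comp (quantumFamily k Γ).toEnv :=
    FreeStarAlgebra.starAlgHom_ext fun x => h x.1 x.2
  exact DFunLike.congr_fun h2 a

end QuantumAlgebra

end Relations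

section QuantumGroup

variable {V : Type u} [Fintype V] [DecidableEq V] {k : ℕ} {Γ : SimpleGraph V} [DecidableRel Γ.Adj]

namespace QuantumRelations

variable {A B : Type u} [CStarAlgebra A] [CStarAlgebra B]

lemma adj_entry {q : V → V → A} (h : QuantumRelations k Γ q) (i j : V) :
    ∑ l, (if Γ.Adj l j then q i l else 0) = ∑ l, (if Γ.Adj i l then q l j else 0) := by
  have h1 := congrFun (congrFun h.adj_comm i) j
  simpa only [Matrix.mul_apply, Matrix.of_apply, SimpleGraph.adjMatrix_apply, mul_ite, ite_mul,
    mul_one, mul_zero, one_mul, zero_mul] using h1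

lemma mul_eq_zero_of_adj {q : V → V → A} (h : QuantumRelations k Γ q) {i i' j j' : V}
    (hi : Γ.Adj i i') (hj : ¬ Γ.Adj j j') : q i j * q i' j' = 0 := by
  have h1 : q i j * (∑ l, if Γ.Adj l j' then q i l else 0) = 0 := by
    rw [Finset.mul_sum]
    refine Finset.sum_eq_zero fun l _ => ?_
    split_ifs with hl
    · rw [h.row_mul, if_neg]
      rintro rfl
      exact hj hl
    · rw [mul_zero]
  have h2 : (∑ l, if Γ.Adj i l then q l j' else 0) * q i' j' = q i' j' := by
    rw [Finset.sum_mul, Finset.sum_eq_single i']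
    · rw [if_pos hi, h.col_mul, if_pos rfl]
    · intro l _ hl
      rw [ite_mul, zero_mul, h.col_mul, if_neg hl, ite_self]
    · exact fun hn => absurd (Finset.mem_univ _) hn
  rw [← h2, ← h.adj_entry, ← mul_assoc, h1, zero_mul]

lemma list_prod_eq_zero {M : Type*} [MonoidWithZero M] : ∀ {m : ℕ} (f : Fin (m + 1) → M)
    (a : Fin m), f a.castSucc * f a.succ = 0 → (List.ofFn f).prod = 0
  | 0, _, a, _ => a.elim0
  | m + 1, f, a, h => by
    rw [List.ofFn_succ, List.prod_cons]
    refine Fin.cases (motive := fun a => f a.castSucc * f a.succ = 0 → _) (fun h => ?_)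
      (fun a h => ?_) a h
    · rw [List.ofFn_succ, List.prod_cons, ← mul_assoc]
      have h' : f 0 * f (Fin.succ 0) = 0 := h
      rw [h', zero_mul]
    · rw [list_prod_eq_zero (fun b => f b.succ) a h, mul_zero]

lemma pathProd_eq_zero {q : V → V → A} (h : QuantumRelations k Γ q) {n : ℕ}
    {i j : Fin (n + 1) → V} (hi : IsPath Γ i) (hj : ¬ IsPath Γ j) : pathProd q i j = 0 := by
  obtain ⟨a, ha⟩ := not_forall.mp hj
  exact list_prod_eq_zero _ a (h.mul_eq_zero_of_adj (hi a) ha)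

lemma star_list_prod (L : List A) : star L.prod = (L.map star).reverse.prod := by
  induction L with
  | nil => exact star_one A
  | cons a L ih =>
    rw [List.prod_cons, star_mul, ih, List.map_cons, List.reverse_cons, List.prod_append,
      List.prod_singleton]

lemma star_pathProd {q : V → V → A} (h : ∀ i j, star (q i j) = q i j) {n : ℕ}
    (i j : Fin n → V) : star (pathProd q i j) = pathProdRev q i j := by
  rw [pathProd, star_list_prod, List.map_ofFn, pathProdRev]
  simp only [Function.comp_def, h]

lemma pathProd_tmul (q : V → V → A) (r : V → V → B) {n : ℕ} (i l j : Fin n → V) :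
    (List.ofFn fun a => MinTensor.tmul (q (i a) (l a)) (r (l a) (j a))).prod =
      MinTensor.tmul (pathProd q i l) (pathProd r l j) := by
  simp only [pathProd]
  induction n with
  | zero => simp only [List.ofFn_zero, List.prod_nil]; exact MinTensor.tmul_one_one.symm
  | succ n ih =>
    simp only [List.ofFn_succ, List.prod_cons]
    rw [MinTensor.tmul_mul, ih (fun a => i a.succ) (fun a => l a.succ) (fun a => j a.succ)]

lemma list_prod_sum {D : Type u} [CStarAlgebra D] {n : ℕ} (f : Fin n → V → D) :
    (List.ofFn fun a => ∑ l, f a l).prod = ∑ l : Fin n → V, (List.ofFn fun a => f a (l a)).prod := by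
  have h := MultilinearMap.map_sum (MultilinearMap.mkPiAlgebraFin ℂ n D) f
  simpa only [MultilinearMap.mkPiAlgebraFin_apply] using h

/-- The products of entries of `∑ l, q_{il} ⊗ r_{lj}`. -/
lemma pathProd_comul (q : V → V → A) (r : V → V → B) {n : ℕ} (i j : Fin n → V) :
    pathProd (fun a b => ∑ l, MinTensor.tmul (q a l) (r l b)) i j =
      ∑ l : Fin n → V, MinTensor.tmul (pathProd q i l) (pathProd r l j) := by
  rw [pathProd, list_prod_sum]
  exact Finset.sum_congr rfl fun l _ => pathProd_tmul q r i l j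

/-- The relations are inherited by the elements `∑ l, q_{il} ⊗ r_{lj}`. -/
theorem comul {q : V → V → A} {r : V → V → B} (hq : QuantumRelations k Γ q)
    (hr : QuantumRelations k Γ r) :
    QuantumRelations k Γ fun i j => ∑ l, MinTensor.tmul (q i l) (r l j) := by
  have hstar : ∀ i j, star (∑ l, MinTensor.tmul (q i l) (r l j)) =
      ∑ l, MinTensor.tmul (q i l) (r l j) := fun i j => by
    rw [star_sum]
    refine Finset.sum_congr rfl fun l _ => ?_
    rw [MinTensor.star_tmul, hq.star_eq, hr.star_eq]
  refine ⟨hstar, fun i => ?_, fun i => ?_, fun i j j' => ?_, fun i j j' => ?_, ?_, ?_⟩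
  · rw [Finset.sum_comm]
    simp only [← MinTensor.tmul_sum, hr.row_sum]
    rw [← MinTensor.sum_tmul, hq.row_sum, MinTensor.tmul_one_one]
  · rw [Finset.sum_comm]
    simp only [← MinTensor.sum_tmul, hq.col_sum]
    rw [← MinTensor.tmul_sum, hr.col_sum, MinTensor.tmul_one_one]
  · rw [Finset.sum_mul]
    have h1 : ∀ l, MinTensor.tmul (q i l) (r l j) * ∑ m, MinTensor.tmul (q i m) (r m j') =
        if j = j' then MinTensor.tmul (q i l) (r l j) else 0 := fun l => by
      rw [Finset.mul_sum, Finset.sum_eq_single l]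
      · rw [← MinTensor.tmul_mul, hq.row_mul, if_pos rfl, hr.row_mul]
        split_ifs
        · rfl
        · exact MinTensor.tmul_zero _
      · intro m _ hm
        rw [← MinTensor.tmul_mul, hq.row_mul, if_neg hm.symm, MinTensor.zero_tmul]
      · exact fun hn => absurd (Finset.mem_univ _) hn
    rw [Finset.sum_congr rfl fun l _ => h1 l]
    split_ifs
    · rfl
    · exact Finset.sum_const_zero
  · rw [Finset.sum_mul]
    have h1 : ∀ l, MinTensor.tmul (q j l) (r l i) * ∑ m, MinTensor.tmul (q j' m) (r m i) =
        if j = j' then MinTensor.tmul (q j l) (r l i) else 0 := fun l => by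
      rw [Finset.mul_sum, Finset.sum_eq_single l]
      · rw [← MinTensor.tmul_mul, hr.col_mul, if_pos rfl, hq.col_mul]
        split_ifs
        · rfl
        · exact MinTensor.zero_tmul _
      · intro m _ hm
        rw [← MinTensor.tmul_mul, hr.col_mul, if_neg hm.symm, MinTensor.tmul_zero]
      · exact fun hn => absurd (Finset.mem_univ _) hn
    rw [Finset.sum_congr rfl fun l _ => h1 l]
    split_ifs
    · rfl
    · exact Finset.sum_const_zero
  · have h1 : (Matrix.of fun i j => ∑ l, MinTensor.tmul (q i l) (r l j)) =
        Matrix.of (fun i l => MinTensor.inclLeft (B := B) (q i l)) *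
          Matrix.of (fun l j => MinTensor.inclRight (A := A) (r l j)) := by
      ext i j
      rw [Matrix.mul_apply]
      refine Finset.sum_congr rfl fun l _ => ?_
      change _ = MinTensor.tmul (q i l) 1 * MinTensor.tmul 1 (r l j)
      rw [← MinTensor.tmul_mul, mul_one, one_mul]
    rw [h1, Matrix.mul_assoc, (hr.map (MinTensor.inclRight (A := A))).adj_comm, ← Matrix.mul_assoc,
      (hq.map (MinTensor.inclLeft (B := B))).adj_comm, Matrix.mul_assoc]
  · intro n hn i j hi hj
    rw [← star_pathProd hstar, pathProd_comul, star_sum]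
    refine Finset.sum_congr rfl fun l _ => ?_
    rw [MinTensor.star_tmul]
    by_cases hl : IsPath Γ l
    · rw [star_pathProd hq.star_eq, star_pathProd hr.star_eq, hq.path_rev n hn i l hi hl,
        hr.path_rev n hn l j hl hj]
    · rw [hq.pathProd_eq_zero hi hl, star_zero, MinTensor.zero_tmul, MinTensor.zero_tmul]

end QuantumRelations

namespace QuantumAlgebra

variable (k Γ) in
/-- The comultiplication of `C(G_k^+(Γ))`: `Δ(q_{ij}) = ∑ l, q_{il} ⊗ q_{lj}`. -/
def comul : QuantumAlgebra k Γ →⋆ₐ[ℂ] MinTensor (QuantumAlgebra k Γ) (QuantumAlgebra k Γ) :=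
  desc (fun i j => ∑ l, MinTensor.tmul (q k Γ i l) (q k Γ l j))
    ((relations k Γ).comul (relations k Γ))

lemma comul_q (i j : V) :
    comul k Γ (q k Γ i j) = ∑ l, MinTensor.tmul (q k Γ i l) (q k Γ l j) := desc_q _ _ i j

lemma coassoc_left (i j : V) :
    MinTensor.map (comul k Γ) (StarAlgHom.id ℂ (QuantumAlgebra k Γ)) (comul k Γ (q k Γ i j)) =
      ∑ l, ∑ m, MinTensor.tmul (MinTensor.tmul (q k Γ i m) (q k Γ m l)) (q k Γ l j) := by
  rw [comul_q, map_sum]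
  refine Finset.sum_congr rfl fun l _ => ?_
  rw [MinTensor.map_tmul, comul_q, MinTensor.sum_tmul]
  rfl

lemma coassoc_right (i j : V) :
    MinTensor.map (StarAlgHom.id ℂ (QuantumAlgebra k Γ)) (comul k Γ) (comul k Γ (q k Γ i j)) =
      ∑ l, ∑ m, MinTensor.tmul (q k Γ i l) (MinTensor.tmul (q k Γ l m) (q k Γ m j)) := by
  rw [comul_q, map_sum]
  refine Finset.sum_congr rfl fun l _ => ?_
  rw [MinTensor.map_tmul, comul_q, MinTensor.tmul_sum]
  rfl

lemma coassoc :
    (MinTensor₃.assocRight (QuantumAlgebra k Γ) (QuantumAlgebra k Γ) (QuantumAlgebra k Γ)).comp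
      ((MinTensor.map (StarAlgHom.id ℂ _) (comul k Γ)).comp (comul k Γ)) =
    (MinTensor₃.assocLeft (QuantumAlgebra k Γ) (QuantumAlgebra k Γ) (QuantumAlgebra k Γ)).comp
      ((MinTensor.map (comul k Γ) (StarAlgHom.id ℂ _)).comp (comul k Γ)) := by
  refine hom_ext fun i j => ?_
  refine (congrArg (MinTensor₃.assocRight _ _ _) (coassoc_right i j)).trans
    (Eq.trans ?_ (congrArg (MinTensor₃.assocLeft _ _ _) (coassoc_left i j)).symm)
  rw [map_sum, map_sum]
  simp only [map_sum, MinTensor₃.assocRight_tmul, MinTensor₃.assocLeft_tmul]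
  exact Finset.sum_comm

/-- A set of elements that contains `1` and the generators and is closed under linear
combinations and products is dense. -/
lemma dense_of_subalgebra (S : Submodule ℂ (QuantumAlgebra k Γ)) (h1 : 1 ∈ S)
    (hq : ∀ i j, ∀ x ∈ S, q k Γ i j * x ∈ S) :
    Dense (S : Set (QuantumAlgebra k Γ)) := by
  have h : ∀ a, (quantumFamily k Γ).toEnv a ∈ S := fun a => by
    induction a using FreeStarAlgebra.induction_on with
    | h1 => rw [map_one]; exact h1
    | hg x a ha => rw [map_mul]; exact hq x.1 x.2 _ ha
    | hadd a b ha hb => rw [map_add]; exact S.add_mem ha hb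
    | hsmul c a ha => rw [map_smul]; exact S.smul_mem c ha
  refine (quantumFamily k Γ).denseRange_toEnv.mono ?_
  rintro _ ⟨a, rfl⟩
  exact h a

end QuantumAlgebra

/-- A linear subspace of `A ⊗_min B` is dense if it contains all `a ⊗ b`, where `a` runs through a
dense subspace. -/
lemma MinTensor.dense_of_left {A B : Type u} [CStarAlgebra A] [CStarAlgebra B]
    (S : Submodule ℂ (MinTensor A B)) (R : Submodule ℂ A) (hR : Dense (R : Set A))
    (h : ∀ a ∈ R, ∀ b, MinTensor.tmul a b ∈ S) : Dense (S : Set (MinTensor A B)) := by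
  have hc : IsClosed (S.topologicalClosure : Set (MinTensor A B)) :=
    S.isClosed_topologicalClosure
  have h1 : ∀ a b, MinTensor.tmul a b ∈ S.topologicalClosure := fun a b => by
    have hcont : Continuous fun a : A => MinTensor.tmul a b := by
      have h2 : (fun a : A => MinTensor.tmul a b) =
          fun a => MinTensor.inclLeft a * MinTensor.tmul 1 b := by
        funext a
        rw [MinTensor.inclLeft_apply, ← MinTensor.tmul_mul, mul_one, one_mul]
      rw [h2]
      exact (MinTensor.continuous_starAlgHom _).mul continuous_const
    refine hR.induction (P := fun a => MinTensor.tmul a b ∈ S.topologicalClosure)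
      (fun a ha => S.le_topologicalClosure (h a ha b)) (hc.preimage hcont) a
  intro x
  have h2 : x ∈ S.topologicalClosure := by
    refine MinTensor.induction_on x hc fun y => ?_
    induction y with
    | zero => rw [map_zero]; exact S.topologicalClosure.zero_mem
    | add x y hx hy => rw [map_add]; exact S.topologicalClosure.add_mem hx hy
    | tmul a b => exact h1 a b
  exact h2

/-- A linear subspace of `A ⊗_min B` is dense if it contains all `a ⊗ b`, where `b` runs through a
dense subspace. -/
lemma MinTensor.dense_of_right {A B : Type u} [CStarAlgebra A] [CStarAlgebra B]
    (S : Submodule ℂ (MinTensor A B)) (R : Submodule ℂ B) (hR : Dense (R : Set B))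
    (h : ∀ a, ∀ b ∈ R, MinTensor.tmul a b ∈ S) : Dense (S : Set (MinTensor A B)) := by
  have hc : IsClosed (S.topologicalClosure : Set (MinTensor A B)) :=
    S.isClosed_topologicalClosure
  have h1 : ∀ a b, MinTensor.tmul a b ∈ S.topologicalClosure := fun a b => by
    have hcont : Continuous fun b : B => MinTensor.tmul a b := by
      have h2 : (fun b : B => MinTensor.tmul a b) =
          fun b => MinTensor.tmul a 1 * MinTensor.inclRight b := by
        funext b
        rw [MinTensor.inclRight_apply, ← MinTensor.tmul_mul, mul_one, one_mul]
      rw [h2]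
      exact continuous_const.mul (MinTensor.continuous_starAlgHom _)
    refine hR.induction (P := fun b => MinTensor.tmul a b ∈ S.topologicalClosure)
      (fun b hb => S.le_topologicalClosure (h a b hb)) (hc.preimage hcont) b
  intro x
  have h2 : x ∈ S.topologicalClosure := by
    refine MinTensor.induction_on x hc fun y => ?_
    induction y with
    | zero => rw [map_zero]; exact S.topologicalClosure.zero_mem
    | add x y hx hy => rw [map_add]; exact S.topologicalClosure.add_mem hx hy
    | tmul a b => exact h1 a b
  exact h2

namespace QuantumAlgebra

variable (k Γ) in
/-- The span of `Δ(a)(1 ⊗ b)`. -/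
def spanRight : Submodule ℂ (MinTensor (QuantumAlgebra k Γ) (QuantumAlgebra k Γ)) :=
  Submodule.span ℂ {x | ∃ a b, x = comul k Γ a * MinTensor.tmul 1 b}

variable (k Γ) in
/-- The span of `Δ(a)(b ⊗ 1)`. -/
def spanLeft : Submodule ℂ (MinTensor (QuantumAlgebra k Γ) (QuantumAlgebra k Γ)) :=
  Submodule.span ℂ {x | ∃ a b, x = comul k Γ a * MinTensor.tmul b 1}

lemma spanRight_mul {x : MinTensor (QuantumAlgebra k Γ) (QuantumAlgebra k Γ)}
    (hx : x ∈ spanRight k Γ) (b : QuantumAlgebra k Γ) :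
    x * MinTensor.tmul 1 b ∈ spanRight k Γ := by
  induction hx using Submodule.span_induction with
  | mem x h =>
    obtain ⟨a, c, rfl⟩ := h
    refine Submodule.subset_span ⟨a, c * b, ?_⟩
    rw [mul_assoc, ← MinTensor.tmul_mul, one_mul]
  | zero => rw [zero_mul]; exact Submodule.zero_mem _
  | add x y _ _ hx hy => rw [add_mul]; exact Submodule.add_mem _ hx hy
  | smul c x _ hx => rw [smul_mul_assoc]; exact Submodule.smul_mem _ c hx

lemma comul_mul_spanRight {x : MinTensor (QuantumAlgebra k Γ) (QuantumAlgebra k Γ)}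
    (hx : x ∈ spanRight k Γ) (b : QuantumAlgebra k Γ) :
    comul k Γ b * x ∈ spanRight k Γ := by
  induction hx using Submodule.span_induction with
  | mem x h =>
    obtain ⟨a, c, rfl⟩ := h
    refine Submodule.subset_span ⟨b * a, c, ?_⟩
    rw [map_mul, mul_assoc]
  | zero => rw [mul_zero]; exact Submodule.zero_mem _
  | add x y _ _ hx hy => rw [mul_add]; exact Submodule.add_mem _ hx hy
  | smul c x _ hx => rw [mul_smul_comm]; exact Submodule.smul_mem _ c hx

lemma spanLeft_mul {x : MinTensor (QuantumAlgebra k Γ) (QuantumAlgebra k Γ)}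
    (hx : x ∈ spanLeft k Γ) (b : QuantumAlgebra k Γ) :
    x * MinTensor.tmul b 1 ∈ spanLeft k Γ := by
  induction hx using Submodule.span_induction with
  | mem x h =>
    obtain ⟨a, c, rfl⟩ := h
    refine Submodule.subset_span ⟨a, c * b, ?_⟩
    rw [mul_assoc, ← MinTensor.tmul_mul, one_mul]
  | zero => rw [zero_mul]; exact Submodule.zero_mem _
  | add x y _ _ hx hy => rw [add_mul]; exact Submodule.add_mem _ hx hy
  | smul c x _ hx => rw [smul_mul_assoc]; exact Submodule.smul_mem _ c hx

lemma comul_mul_spanLeft {x : MinTensor (QuantumAlgebra k Γ) (QuantumAlgebra k Γ)}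
    (hx : x ∈ spanLeft k Γ) (b : QuantumAlgebra k Γ) :
    comul k Γ b * x ∈ spanLeft k Γ := by
  induction hx using Submodule.span_induction with
  | mem x h =>
    obtain ⟨a, c, rfl⟩ := h
    refine Submodule.subset_span ⟨b * a, c, ?_⟩
    rw [map_mul, mul_assoc]
  | zero => rw [mul_zero]; exact Submodule.zero_mem _
  | add x y _ _ hx hy => rw [mul_add]; exact Submodule.add_mem _ hx hy
  | smul c x _ hx => rw [mul_smul_comm]; exact Submodule.smul_mem _ c hx

lemma q_tmul_one (i j : V) : MinTensor.tmul (q k Γ i j) (1 : QuantumAlgebra k Γ) =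
    ∑ l, comul k Γ (q k Γ i l) * MinTensor.tmul 1 (q k Γ j l) := by
  have h1 : ∀ l, comul k Γ (q k Γ i l) * MinTensor.tmul 1 (q k Γ j l) =
      MinTensor.tmul (q k Γ i j) (q k Γ j l) := fun l => by
    rw [comul_q, Finset.sum_mul, Finset.sum_eq_single j]
    · rw [← MinTensor.tmul_mul, mul_one, (relations k Γ).col_mul, if_pos rfl]
    · intro m _ hm
      rw [← MinTensor.tmul_mul, (relations k Γ).col_mul, if_neg hm, MinTensor.tmul_zero]
    · exact fun hn => absurd (Finset.mem_univ _) hn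
  simp only [h1]
  rw [← MinTensor.tmul_sum, (relations k Γ).row_sum]

lemma one_tmul_q (i j : V) : MinTensor.tmul (1 : QuantumAlgebra k Γ) (q k Γ i j) =
    ∑ l, comul k Γ (q k Γ l j) * MinTensor.tmul (q k Γ l i) 1 := by
  have h1 : ∀ l, comul k Γ (q k Γ l j) * MinTensor.tmul (q k Γ l i) 1 =
      MinTensor.tmul (q k Γ l i) (q k Γ i j) := fun l => by
    rw [comul_q, Finset.sum_mul, Finset.sum_eq_single i]
    · rw [← MinTensor.tmul_mul, mul_one, (relations k Γ).row_mul, if_pos rfl]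
    · intro m _ hm
      rw [← MinTensor.tmul_mul, (relations k Γ).row_mul, if_neg hm, MinTensor.zero_tmul]
    · exact fun hn => absurd (Finset.mem_univ _) hn
  simp only [h1]
  rw [← MinTensor.sum_tmul, (relations k Γ).col_sum]

lemma dense_right : Dense (spanRight k Γ : Set (MinTensor (QuantumAlgebra k Γ) (QuantumAlgebra k Γ))) := by
  let R : Submodule ℂ (QuantumAlgebra k Γ) :=
    (spanRight k Γ).comap (MinTensor.inclLeft (B := QuantumAlgebra k Γ)).toAlgHom.toLinearMap
  have hmem : ∀ a, a ∈ R ↔ MinTensor.tmul a 1 ∈ spanRight k Γ := fun a => Iff.rfl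
  refine MinTensor.dense_of_left _ R (dense_of_subalgebra R ?_ ?_) fun a ha b => ?_
  · refine (hmem 1).2 (Submodule.subset_span ⟨1, 1, ?_⟩)
    rw [map_one, one_mul]
  · intro i j x hx
    have h1 : MinTensor.tmul (q k Γ i j * x) (1 : QuantumAlgebra k Γ) = ∑ l,
        comul k Γ (q k Γ i l) * (MinTensor.tmul x 1 * MinTensor.tmul 1 (q k Γ j l)) := by
      have h2 : ∀ l, MinTensor.tmul x 1 * MinTensor.tmul 1 (q k Γ j l) =
          MinTensor.tmul 1 (q k Γ j l) * MinTensor.tmul x 1 := fun l =>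
        MinTensor.commute_incl x (q k Γ j l)
      simp only [h2, ← mul_assoc]
      rw [← Finset.sum_mul, ← q_tmul_one, ← MinTensor.tmul_mul, one_mul]
    rw [hmem, h1]
    exact Submodule.sum_mem _ fun l _ => comul_mul_spanRight (spanRight_mul ((hmem x).1 hx) _) _
  · have h1 : MinTensor.tmul a b = MinTensor.tmul a 1 * MinTensor.tmul 1 b := by
      rw [← MinTensor.tmul_mul, mul_one, one_mul]
    rw [h1]
    exact spanRight_mul ((hmem a).1 ha) b

lemma dense_left : Dense (spanLeft k Γ : Set (MinTensor (QuantumAlgebra k Γ) (QuantumAlgebra k Γ))) := by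
  let R : Submodule ℂ (QuantumAlgebra k Γ) :=
    (spanLeft k Γ).comap (MinTensor.inclRight (A := QuantumAlgebra k Γ)).toAlgHom.toLinearMap
  have hmem : ∀ a, a ∈ R ↔ MinTensor.tmul 1 a ∈ spanLeft k Γ := fun a => Iff.rfl
  refine MinTensor.dense_of_right _ R (dense_of_subalgebra R ?_ ?_) fun b a ha => ?_
  · refine (hmem 1).2 (Submodule.subset_span ⟨1, 1, ?_⟩)
    rw [map_one, one_mul]
  · intro i j x hx
    have h1 : MinTensor.tmul (1 : QuantumAlgebra k Γ) (q k Γ i j * x) = ∑ l,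
        comul k Γ (q k Γ l j) * (MinTensor.tmul 1 x * MinTensor.tmul (q k Γ l i) 1) := by
      have h2 : ∀ l, MinTensor.tmul 1 x * MinTensor.tmul (q k Γ l i) 1 =
          MinTensor.tmul (q k Γ l i) 1 * MinTensor.tmul 1 x := fun l =>
        (MinTensor.commute_incl (q k Γ l i) x).symm
      simp only [h2, ← mul_assoc]
      rw [← Finset.sum_mul, ← one_tmul_q, ← MinTensor.tmul_mul, one_mul]
    rw [hmem, h1]
    exact Submodule.sum_mem _ fun l _ => comul_mul_spanLeft (spanLeft_mul ((hmem x).1 hx) _) _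
  · have h1 : MinTensor.tmul b a = MinTensor.tmul 1 a * MinTensor.tmul b 1 := by
      rw [← MinTensor.tmul_mul, mul_one, one_mul]
    rw [h1]
    exact spanLeft_mul ((hmem a).1 ha) b

end QuantumAlgebra

variable (k Γ) in
/-- The compact quantum group `G_k^+(Γ)`. -/
def quantumGroup : CompactQuantumGroup.{u} where
  alg := QuantumAlgebra k Γ
  comul := QuantumAlgebra.comul k Γ
  coassoc := QuantumAlgebra.coassoc
  dense_right := QuantumAlgebra.dense_right
  dense_left := QuantumAlgebra.dense_left

end QuantumGroup

/-! ### The path space and the tensor powers of the fundamental corepresentation -/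

section PathSpace

variable {V : Type u} [Fintype V] [DecidableEq V]

/-- The path space `E^γ`: the paths of length `γ` in `Γ`, that is, the tuples `(i₁, …, i_{γ+1})`
of vertices with consecutive entries adjacent. -/
def PathSpace (Γ : SimpleGraph V) (γ : ℕ) : Type u := {p : Fin (γ + 1) → V // IsPath Γ p}

instance (Γ : SimpleGraph V) [DecidableRel Γ.Adj] (γ : ℕ) : Fintype (PathSpace Γ γ) :=
  inferInstanceAs (Fintype {p : Fin (γ + 1) → V // IsPath Γ p})

/-- The inclusion of `C(E^γ)`, the span of the `χ_{i₁…i_{γ+1}}` with `(i₁, …, i_{γ+1})` a path,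
into `C(V × ⋯ × V)`: extension by zero. -/
def pathIncl (Γ : SimpleGraph V) [DecidableRel Γ.Adj] (γ : ℕ) :
    (PathSpace Γ γ → ℂ) →ₗ[ℂ] ((Fin (γ + 1) → V) → ℂ) where
  toFun f i := if h : IsPath Γ i then f ⟨i, h⟩ else 0
  map_add' f g := by
    funext i
    simp only [Pi.add_apply]
    split_ifs
    · rfl
    · rw [add_zero]
  map_smul' c f := by
    funext i
    simp only [Pi.smul_apply, RingHom.id_apply]
    split_ifs
    · rfl
    · rw [smul_zero]

/-- The tensor power `u^{⊗ m}` of the corepresentation `u(χ_i) = ∑ j, χ_j ⊗ q_{ji}` of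
`G_k^+(Γ)` on `C(V)`, as a linear map on `C(V × ⋯ × V)`:
`u^{⊗ m}(χ_{i₁…iₘ}) = ∑ j, χ_{j₁…jₘ} ⊗ q_{j₁i₁} ⋯ q_{jₘiₘ}`. -/
def tensorPower (k : ℕ) (Γ : SimpleGraph V) [DecidableRel Γ.Adj] (m : ℕ) :
    ((Fin m → V) → ℂ) →ₗ[ℂ] ((Fin m → V) → ℂ) ⊗[ℂ] QuantumAlgebra k Γ :=
  Fintype.linearCombination ℂ fun i : Fin m → V =>
    ∑ j : Fin m → V, (Pi.single j 1 : (Fin m → V) → ℂ) ⊗ₜ[ℂ]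
      pathProd (QuantumAlgebra.q k Γ) j i

end PathSpace

end

/-! Write P(i,j) = `pathProd q i j` for the product q_{i₁j₁} ⋯ q_{i_{γ+1}j_{γ+1}}. The restriction
of u^{⊗(γ+1)} to C(E^γ) is χ_i ↦ ∑_j χ_j ⊗ P(j,i), and the theorem reduces to the claim that the
matrix of the P(j,i), indexed by paths, is again a magic unitary with Δ(P(j,i)) = ∑_l P(j,l) ⊗
P(l,i).

Invariance of C(E^γ) comes from the adjacency relation alone. Since q commutes with ε,
q_{ij}q_{i'j'} = 0 as soon as exactly one of the pairs (i,i') and (j,j') is an edge. So P(i,j) = 0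
if one of i, j is a path and the other is not. The same vanishing turns sums over all tuples into
sums over paths: the row sums ∑_j P(i,j) multiply out to ∏_a ∑_l q_{i_a l} = 1, and the coproduct of
P(j,i) is supported on intermediate paths (`sum_paths`, `sum_pathProd`, `comul_pathCoeff`).

The remaining relations need the reversal relation, which is available because a path of length γ ≤
k has at most k + 1 vertices. Reversing a product of self-adjoint elements is taking its adjoint, so
P(i,j) is self-adjoint for paths i, j. For orthogonality within a row (`pathProd_mul_eq_zero`) the
first factor of P(i,j) is moved to the end, where it meets the first factor of P(i,j'). If j and j'
start at different vertices the product vanishes; otherwise the shared entry is moved past the tail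
of P(i,j') and induction on the length applies to the tails. Idempotency follows by multiplying the
row sum 1 = ∑_l P(i,l) by P(i,j) (`pathProd_mul`). Column relations follow because the defining
relations are symmetric under transposition.

Consequently the elements ∑_j χ_j ⊗ P(j,i) form a partition of unity into orthogonal projections,
which is the same thing as a unital *-homomorphism on the commutative algebra C(E^γ). The coaction
identity is the coproduct formula, and density follows from χ_j ⊗ 1 = ∑_i α(χ_i)(1 ⊗ P(j,i))
(`single_tmul_one`). -/

noncomputable section

/-! ### Homomorphisms on finite-dimensional commutative algebras. -/

section StarHomOfProjections

variable {ι D : Type u} [Fintype ι] [CStarAlgebra D]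

/-- The unital `*`-homomorphism `f ↦ ∑ i, f i • p i` on `C(ι)` that belongs to a partition of unity
into pairwise orthogonal projections. -/
def starHomOfProjections [DecidableEq ι] (p : ι → D) (hstar : ∀ i, star (p i) = p i)
    (hmul : ∀ i j, p i * p j = if i = j then p i else 0) (hsum : ∑ i, p i = 1) :
    (ι → ℂ) →⋆ₐ[ℂ] D where
  toFun f := ∑ i, f i • p i
  map_one' := by simp only [Pi.one_apply, one_smul, hsum]
  map_mul' f g := by
    simp only [Finset.sum_mul_sum, smul_mul_smul_comm, hmul, smul_ite, smul_zero,
      Finset.sum_ite_eq, Finset.mem_univ, if_true, Pi.mul_apply]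
  map_zero' := by simp only [Pi.zero_apply, zero_smul, Finset.sum_const_zero]
  map_add' f g := by simp only [Pi.add_apply, add_smul, Finset.sum_add_distrib]
  commutes' c := by
    simp only [Pi.algebraMap_apply, Algebra.algebraMap_self, RingHom.id_apply]
    rw [← Finset.smul_sum, hsum, Algebra.algebraMap_eq_smul_one]
  map_star' f := by
    rw [star_sum]
    simp only [star_smul, hstar, Pi.star_apply]

lemma starAlgHom_pi_ext [DecidableEq ι] {φ ψ : (ι → ℂ) →⋆ₐ[ℂ] D}
    (h : ∀ i, φ (Pi.single i 1) = ψ (Pi.single i 1)) : φ = ψ := by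
  ext f
  rw [pi_eq_sum_univ' f, map_sum, map_sum]
  exact Finset.sum_congr rfl fun i _ => by rw [map_smul, map_smul, h]

end StarHomOfProjections

/-! ### The products along paths form a magic unitary. -/

namespace QuantumRelations

variable {V : Type u} [Fintype V] [DecidableEq V] {k : ℕ} {Γ : SimpleGraph V} [DecidableRel Γ.Adj]
  {A : Type u} [CStarAlgebra A] {q : V → V → A}

/-- The relations are invariant under transposition. -/
theorem transpose (h : QuantumRelations k Γ q) : QuantumRelations k Γ fun i j => q j i where
  star_eq i j := h.star_eq j i
  row_sum := h.col_sum
  col_sum := h.row_sum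
  row_mul i j l := h.col_mul i j l
  col_mul i j l := h.row_mul i j l
  adj_comm := by
    ext i j
    simp only [Matrix.mul_apply, Matrix.of_apply, SimpleGraph.adjMatrix_apply, mul_ite, ite_mul,
      mul_one, mul_zero, one_mul, zero_mul]
    -- As ε is symmetric, the (i,j) entry of the relation for the transpose is the (j,i) entry of qε
    -- = εq with its two sides exchanged.
    have h1 := h.adj_entry j i
    simp only [Γ.adj_comm _ i, Γ.adj_comm j] at h1
    exact h1.symm
  path_rev n hn i j hi hj := h.path_rev n hn j i hj hi

lemma pathProd_succ {M : Type*} [Monoid M] (q : V → V → M) {n : ℕ} (i j : Fin (n + 1) → V) :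
    pathProd q i j = q (i 0) (j 0) * pathProd q (fun a => i a.succ) (fun a => j a.succ) := by
  rw [pathProd, List.ofFn_succ, List.prod_cons]
  rfl

lemma pathProdRev_succ {M : Type*} [Monoid M] (q : V → V → M) {n : ℕ} (i j : Fin (n + 1) → V) :
    pathProdRev q i j = pathProdRev q (fun a => i a.succ) (fun a => j a.succ) * q (i 0) (j 0) := by
  rw [pathProdRev, List.ofFn_succ, List.reverse_cons, List.prod_append, List.prod_singleton]
  rfl

/-- The mirror image of `pathProd_eq_zero` under transposition. In this form it says that
u^{⊗(n+1)}(χ_j), for a path j, has no component outside the path space. -/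
lemma pathProd_eq_zero_left (h : QuantumRelations k Γ q) {n : ℕ}
    {i j : Fin (n + 1) → V} (hi : ¬ IsPath Γ i) (hj : IsPath Γ j) : pathProd q i j = 0 :=
  h.transpose.pathProd_eq_zero hj hi

/-- The adjoint of a product of self-adjoint entries is the reversed product, so the reversal
relation is precisely self-adjointness of the path products. -/
lemma star_pathProd_self (h : QuantumRelations k Γ q) {n : ℕ} (hn : n ≤ k)
    {i j : Fin (n + 1) → V} (hi : IsPath Γ i) (hj : IsPath Γ j) :
    star (pathProd q i j) = pathProd q i j := by
  rw [star_pathProd h.star_eq, h.path_rev n hn i j hi hj]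

/-- Reversing the whole product brings the first factor to the end, and reversing the tail alone
restores the order of the other factors. The tails of the two paths are paths again, so the relation
applies to both lengths. Thus the first entry commutes with the product of the remaining ones. -/
lemma pathProd_succ_comm (h : QuantumRelations k Γ q) {n : ℕ} (hn : n + 1 ≤ k)
    {i j : Fin (n + 2) → V} (hi : IsPath Γ i) (hj : IsPath Γ j) :
    pathProd q i j = pathProd q (fun a => i a.succ) (fun a => j a.succ) * q (i 0) (j 0) := by
  rw [h.path_rev (n + 1) hn i j hi hj, pathProdRev_succ, h.path_rev n (Nat.le_of_succ_le hn) _ _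
    (fun a => hi a.succ) (fun a => hj a.succ)]

/-- Without the reversal relation the factors of P(i,j) and P(i,j') that belong to the same vertex
of i are separated by other factors. `pathProd_succ_comm` brings those of the first vertex together,
and the induction peels off one vertex at a time. -/
lemma pathProd_mul_eq_zero (h : QuantumRelations k Γ q) {n : ℕ} (hn : n ≤ k)
    {i j j' : Fin (n + 1) → V} (hi : IsPath Γ i) (hj : IsPath Γ j) (hj' : IsPath Γ j')
    (hne : j ≠ j') : pathProd q i j * pathProd q i j' = 0 := by
  induction n with
  | zero =>
    -- A path of length 0 is a single vertex, so this case is row orthogonality of q.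
    have h0 : j 0 ≠ j' 0 := fun h0 => hne (funext fun a => (Fin.fin_one_eq_zero a).symm ▸ h0)
    simp only [pathProd, List.ofFn_succ, List.ofFn_zero, List.prod_cons, List.prod_nil, mul_one]
    rw [h.row_mul, if_neg h0]
  | succ n ih =>
    -- With its first entry moved to the right end, the left product stands as tail times q_{i₁j₁},
    -- next to q_{i₁j'₁} times the other tail. The row relation for q then merges the two middle
    -- entries.
    rw [h.pathProd_succ_comm hn hi hj, pathProd_succ q i j', mul_assoc, ← mul_assoc (q _ _),
      h.row_mul]
    split_ifs with h0
    · have ht : (fun a : Fin (n + 1) => j a.succ) ≠ fun a => j' a.succ := fun ht =>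
        hne (funext fun a => Fin.cases h0 (fun a => congrFun ht a) a)
      -- The merged entry and the tail on its right recombine to P(i,j'). Moving the entry to the
      -- end of this product leaves the two tails adjacent; they have different column paths, so the
      -- induction hypothesis applies.
      rw [h0, ← pathProd_succ, h.pathProd_succ_comm hn hi hj', ← mul_assoc,
        ih (Nat.le_of_succ_le hn) (fun a => hi a.succ) (fun a => hj a.succ)
          (fun a => hj' a.succ) ht, zero_mul]
    · rw [zero_mul, mul_zero]

/-- Expanding ∏_a ∑_l q_{i_a l}, in which every factor is 1, produces exactly one term for each
tuple j. -/
lemma sum_pathProd_all (h : QuantumRelations k Γ q) {n : ℕ} (i : Fin n → V) :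
    ∑ j : Fin n → V, pathProd q i j = 1 := by
  have h1 := list_prod_sum fun a l => q (i a) l
  simp only [h.row_sum, List.ofFn_const, List.prod_replicate, one_pow] at h1
  exact h1.symm

/-- The passage between sums over all tuples, which arise from expanding products, and sums over
E^n. It is applied to summands that contain a product P with one index a path, and these vanish when
the other index is not one. -/
lemma sum_paths {M : Type*} [AddCommMonoid M] {n : ℕ} (f : (Fin (n + 1) → V) → M)
    (hf : ∀ j, ¬ IsPath Γ j → f j = 0) : ∑ j : PathSpace Γ n, f j.1 = ∑ j, f j := by
  classical
  refine Finset.sum_of_injOn (fun j : PathSpace Γ n => j.1) Subtype.val_injective.injOn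
    (fun _ _ => Finset.mem_coe.2 (Finset.mem_univ _)) (fun j _ hj => hf j fun hp => hj ?_)
    fun _ _ => rfl
  exact ⟨⟨j, hp⟩, Finset.mem_coe.2 (Finset.mem_univ _), rfl⟩

lemma sum_pathProd (h : QuantumRelations k Γ q) {n : ℕ} (i : PathSpace Γ n) :
    ∑ j : PathSpace Γ n, pathProd q i.1 j.1 = 1 := by
  rw [sum_paths (fun j => pathProd q i.1 j) fun j hj => h.pathProd_eq_zero i.2 hj,
    h.sum_pathProd_all]

instance {n : ℕ} : DecidableEq (PathSpace Γ n) :=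
  inferInstanceAs (DecidableEq {p : Fin (n + 1) → V // IsPath Γ p})

/-- The products along paths of length at most `k` have orthogonal idempotent rows. -/
theorem pathProd_mul (h : QuantumRelations k Γ q) {n : ℕ} (hn : n ≤ k) (i j j' : PathSpace Γ n) :
    pathProd q i.1 j.1 * pathProd q i.1 j'.1 = if j = j' then pathProd q i.1 j.1 else 0 := by
  have h0 : ∀ l, j ≠ l → pathProd q i.1 j.1 * pathProd q i.1 l.1 = 0 := fun l hl =>
    h.pathProd_mul_eq_zero hn i.2 j.2 l.2 fun he => hl (Subtype.ext he)
  split_ifs with hj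
  · subst hj
    -- Idempotency needs no second induction: multiply ∑_l P(i,l) = 1 on the left by P(i,j), and
    -- orthogonality leaves only P(i,j)² on the left-hand side.
    have h1 := congrArg (pathProd q i.1 j.1 * ·) (h.sum_pathProd i)
    simp only [Finset.mul_sum, mul_one] at h1
    rwa [Finset.sum_eq_single j (fun l _ hl => h0 l hl.symm)
      fun hn => absurd (Finset.mem_univ _) hn] at h1
  · exact h0 j' hj

end QuantumRelations

/-! ### Restriction of the tensor power to the path space. -/

section PathCoaction

open QuantumAlgebra

variable {V : Type u} [Fintype V] [DecidableEq V]

/-- The matrix coefficients of the corepresentation on the path space. -/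
abbrev pathCoeff (k : ℕ) (Γ : SimpleGraph V) [DecidableRel Γ.Adj] {γ : ℕ} (j i : PathSpace Γ γ) :
    QuantumAlgebra k Γ :=
  pathProd (q k Γ) j.1 i.1

/-- The restriction of `u^{⊗ (γ + 1)}` to `C(E^γ)`. -/
def pathCorep (k : ℕ) (Γ : SimpleGraph V) [DecidableRel Γ.Adj] (γ : ℕ) :
    (PathSpace Γ γ → ℂ) →ₗ[ℂ] (PathSpace Γ γ → ℂ) ⊗[ℂ] QuantumAlgebra k Γ :=
  Fintype.linearCombination ℂ fun i : PathSpace Γ γ =>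
    ∑ j : PathSpace Γ γ, (Pi.single j 1 : PathSpace Γ γ → ℂ) ⊗ₜ[ℂ] pathCoeff k Γ j i

variable {k : ℕ} {Γ : SimpleGraph V} [DecidableRel Γ.Adj] {γ : ℕ}

lemma pathIncl_single (i : PathSpace Γ γ) :
    pathIncl Γ γ (Pi.single i 1) = Pi.single i.1 1 := by
  funext j
  change (if h : IsPath Γ j then (Pi.single i 1 : PathSpace Γ γ → ℂ) ⟨j, h⟩ else 0) = _
  by_cases hj : j = i.1
  · subst hj
    rw [Pi.single_eq_same]
    exact (dif_pos i.2).trans (Pi.single_eq_same i 1)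
  · rw [Pi.single_eq_of_ne hj]
    split_ifs with h
    · exact Pi.single_eq_of_ne (fun he => hj (congrArg Subtype.val he)) 1
    · rfl

/-- This is the invariance of C(E^γ). By linearity it is enough to take f = χ_i for a path i. In the
full expansion of u^{⊗(γ+1)}(χ_i) the terms χ_j ⊗ P(j,i) with j not a path are zero, and the others
are the terms of `pathCorep`. Only the vanishing that results from the adjacency relation enters, so
no bound on γ is required. -/
lemma rTensor_pathCorep (f : PathSpace Γ γ → ℂ) :
    (pathIncl Γ γ).rTensor (QuantumAlgebra k Γ) (pathCorep k Γ γ f) =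
      tensorPower k Γ (γ + 1) (pathIncl Γ γ f) := by
  have h : (pathIncl Γ γ).rTensor (QuantumAlgebra k Γ) ∘ₗ pathCorep k Γ γ =
      tensorPower k Γ (γ + 1) ∘ₗ pathIncl Γ γ := by
    refine LinearMap.pi_ext' fun i => LinearMap.ext_ring ?_
    change (pathIncl Γ γ).rTensor _ (pathCorep k Γ γ (Pi.single i 1)) =
      tensorPower k Γ (γ + 1) (pathIncl Γ γ (Pi.single i 1))
    rw [pathIncl_single, pathCorep, tensorPower, Fintype.linearCombination_apply_single,
      Fintype.linearCombination_apply_single, one_smul, one_smul, map_sum]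
    simp only [LinearMap.rTensor_tmul, pathIncl_single]
    refine QuantumRelations.sum_paths (fun j => (Pi.single j 1 : (Fin (γ + 1) → V) → ℂ) ⊗ₜ[ℂ]
      pathProd (q k Γ) j i.1) fun j hj => ?_
    rw [(relations k Γ).pathProd_eq_zero_left hj i.2, TensorProduct.tmul_zero]
  exact LinearMap.congr_fun h f

/-! ### The *-homomorphism on the path space. -/

lemma sum_single_one {ι : Type*} [Fintype ι] [DecidableEq ι] :
    ∑ j : ι, (Pi.single j 1 : ι → ℂ) = 1 :=
  Finset.univ_sum_single (1 : ι → ℂ)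

/-- The χ_j are orthogonal idempotents, so elements of this shape multiply like B-valued functions
on ι, pointwise in j. -/
lemma sum_tmul_single_mul {ι B : Type u} [Fintype ι] [DecidableEq ι] [CStarAlgebra B]
    (a b : ι → B) :
    (∑ j, MinTensor.tmul (Pi.single j 1 : ι → ℂ) (a j)) *
        ∑ j, MinTensor.tmul (Pi.single j 1 : ι → ℂ) (b j) =
      ∑ j, MinTensor.tmul (Pi.single j 1 : ι → ℂ) (a j * b j) := by
  rw [Finset.sum_mul]
  refine Finset.sum_congr rfl fun j _ => ?_
  rw [Finset.mul_sum, Finset.sum_eq_single j]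
  · rw [← MinTensor.tmul_mul, ← Pi.single_mul, one_mul]
  · intro l _ hl
    have h0 : (Pi.single j 1 : ι → ℂ) * Pi.single l 1 = 0 := by
      funext m
      simp only [Pi.mul_apply, Pi.single_apply, Pi.zero_apply]
      split_ifs with h1 h2
      · exact absurd (h2.symm.trans h1) hl
      all_goals simp
    rw [← MinTensor.tmul_mul, h0, MinTensor.zero_tmul]
  · exact fun hn => absurd (Finset.mem_univ _) hn

/-- The image of `χ_i` under the coaction on the path space. -/
def pathProj (k : ℕ) (Γ : SimpleGraph V) [DecidableRel Γ.Adj] {γ : ℕ} (i : PathSpace Γ γ) :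
    MinTensor (PathSpace Γ γ → ℂ) (QuantumAlgebra k Γ) :=
  ∑ j, MinTensor.tmul (Pi.single j 1 : PathSpace Γ γ → ℂ) (pathCoeff k Γ j i)

/-- The coaction on the path space, as a `*`-homomorphism. -/
def pathHom (Γ : SimpleGraph V) [DecidableRel Γ.Adj] (hγ : γ ≤ k) :
    (PathSpace Γ γ → ℂ) →⋆ₐ[ℂ] MinTensor (PathSpace Γ γ → ℂ) (QuantumAlgebra k Γ) :=
  starHomOfProjections (pathProj k Γ)
    (fun i => by
      rw [pathProj, star_sum]
      refine Finset.sum_congr rfl fun j _ => ?_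
      rw [MinTensor.star_tmul, (relations k Γ).star_pathProd_self hγ j.2 i.2, Pi.star_single,
        star_one])
    (fun i i' => by
      -- Multiplication is pointwise in j, so only products P(j,i)P(j,i') within one row appear and
      -- row orthogonality of the path products suffices.
      rw [pathProj, pathProj, sum_tmul_single_mul]
      simp only [(relations k Γ).pathProd_mul hγ]
      split_ifs
      · rfl
      · simp only [MinTensor.tmul_zero, Finset.sum_const_zero])
    (by
      simp only [pathProj]
      -- Summing over i first gives, for each j, the row sum ∑_i P(j,i) = 1. What is left is ∑_j χ_j
      -- ⊗ 1.
      rw [Finset.sum_comm]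
      simp only [← MinTensor.tmul_sum, (relations k Γ).sum_pathProd]
      rw [← MinTensor.sum_tmul, sum_single_one, MinTensor.tmul_one_one])

lemma pathHom_single (hγ : γ ≤ k) (i : PathSpace Γ γ) :
    pathHom Γ hγ (Pi.single i 1) = pathProj k Γ i := by
  change ∑ l, (Pi.single i 1 : PathSpace Γ γ → ℂ) l • pathProj k Γ l = _
  simp only [Pi.single_apply, ite_smul, one_smul, zero_smul, Finset.sum_ite_eq', Finset.mem_univ,
    if_true]

/-- The homomorphism was built from projections inside the minimal tensor product. This identifies
it with the linear map obtained by restricting u^{⊗(γ+1)}, which takes values in the algebraic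
tensor product. -/
lemma pathHom_apply (hγ : γ ≤ k) (f : PathSpace Γ γ → ℂ) :
    pathHom Γ hγ f =
      MinTensor.ofAlg (PathSpace Γ γ → ℂ) (QuantumAlgebra k Γ) (pathCorep k Γ γ f) := by
  rw [pathCorep, Fintype.linearCombination_apply, map_sum]
  refine Finset.sum_congr rfl fun i _ => ?_
  rw [map_smul, map_sum]
  rfl

/-- Multiplying out Δ(q_{j₁i₁}) ⋯ Δ(q_{j_{γ+1}i_{γ+1}}) gives a sum over all intermediate tuples l.
If l is not a path then the left leg P(j,l) is zero because j is one, so the path products by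
themselves form a corepresentation matrix. -/
lemma comul_pathCoeff (i j : PathSpace Γ γ) :
    QuantumAlgebra.comul k Γ (pathCoeff k Γ j i) =
      ∑ l : PathSpace Γ γ, MinTensor.tmul (pathCoeff k Γ j l) (pathCoeff k Γ l i) := by
  rw [pathCoeff, map_pathProd]
  simp only [comul_q]
  rw [QuantumRelations.pathProd_comul]
  refine (QuantumRelations.sum_paths (Γ := Γ) (fun l => MinTensor.tmul (pathProd (q k Γ) j.1 l)
    (pathProd (q k Γ) l i.1)) fun l hl => ?_).symm
  rw [(relations k Γ).pathProd_eq_zero j.2 hl, MinTensor.zero_tmul]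

/-- On χ_i both composites give the double sum of χ_j ⊗ P(j,l) ⊗ P(l,i) over paths j and l. The
outer sum runs over j when the comultiplication is applied second, and over l when the coaction is
applied twice. -/
lemma pathHom_coaction (hγ : γ ≤ k) :
    (MinTensor₃.assocRight (PathSpace Γ γ → ℂ) (QuantumAlgebra k Γ) (QuantumAlgebra k Γ)).comp
      ((MinTensor.map (StarAlgHom.id ℂ _) (QuantumAlgebra.comul k Γ)).comp (pathHom Γ hγ)) =
    (MinTensor₃.assocLeft (PathSpace Γ γ → ℂ) (QuantumAlgebra k Γ) (QuantumAlgebra k Γ)).comp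
      ((MinTensor.map (pathHom Γ hγ) (StarAlgHom.id ℂ _)).comp (pathHom Γ hγ)) := by
  refine starAlgHom_pi_ext fun i => ?_
  simp only [StarAlgHom.comp_apply, pathHom_single, pathProj, map_sum, MinTensor.map_tmul,
    comul_pathCoeff, MinTensor.tmul_sum, MinTensor.sum_tmul, MinTensor₃.assocRight_tmul,
    MinTensor₃.assocLeft_tmul, StarAlgHom.coe_id, id_eq]
  exact Finset.sum_comm

/-- The inverse of the magic unitary of path products is its transpose, and the identity expresses
this: the product with index i contains the terms χ_l ⊗ P(l,i)P(j,i), column orthogonality leaves l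
= j, and ∑_i P(j,i) = 1. It is the source of the density condition. -/
lemma single_tmul_one (hγ : γ ≤ k) (j : PathSpace Γ γ) :
    MinTensor.tmul (Pi.single j 1 : PathSpace Γ γ → ℂ) (1 : QuantumAlgebra k Γ) =
      ∑ i, pathHom Γ hγ (Pi.single i 1) * MinTensor.tmul 1 (pathCoeff k Γ j i) := by
  have h1 : ∀ i, pathHom Γ hγ (Pi.single i 1) * MinTensor.tmul 1 (pathCoeff k Γ j i) =
      MinTensor.tmul (Pi.single j 1) (pathCoeff k Γ j i) := fun i => by
    rw [pathHom_single, pathProj, Finset.sum_mul, Finset.sum_eq_single j]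
    · rw [← MinTensor.tmul_mul, mul_one, (relations k Γ).pathProd_mul hγ, if_pos rfl]
    · intro l _ hl
      have h0 : pathCoeff k Γ l i * pathCoeff k Γ j i = 0 :=
        -- Column orthogonality is row orthogonality for the transposed family, which satisfies the
        -- same relations.
        ((relations k Γ).transpose.pathProd_mul hγ i l j).trans (if_neg hl)
      rw [← MinTensor.tmul_mul, h0, MinTensor.tmul_zero]
    · exact fun hn => absurd (Finset.mem_univ _) hn
  simp only [h1]
  rw [← MinTensor.tmul_sum, (relations k Γ).sum_pathProd]

lemma dense_pathHom (hγ : γ ≤ k) : Dense (Submodule.span ℂ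
    {x : MinTensor (PathSpace Γ γ → ℂ) (QuantumAlgebra k Γ) |
      ∃ a b, x = pathHom Γ hγ a * MinTensor.tmul 1 b} :
    Set (MinTensor (PathSpace Γ γ → ℂ) (QuantumAlgebra k Γ))) := by
  -- No approximation in the first leg is needed: the span contains every elementary tensor f ⊗ b,
  -- as the expansion of f in the basis χ_j shows.
  refine MinTensor.dense_of_left _ ⊤ dense_univ fun f _ b => ?_
  rw [pi_eq_sum_univ' f, MinTensor.sum_tmul]
  refine Submodule.sum_mem _ fun j _ => ?_
  rw [MinTensor.smul_tmul]
  refine Submodule.smul_mem _ _ ?_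
  have h1 : MinTensor.tmul (Pi.single j 1 : PathSpace Γ γ → ℂ) b =
      MinTensor.tmul (Pi.single j 1) 1 * MinTensor.tmul 1 b := by
    rw [← MinTensor.tmul_mul, mul_one, one_mul]
  -- The factor 1 ⊗ b is absorbed into 1 ⊗ P(j,i) on the right, so each term keeps the form α(χ_i)(1
  -- ⊗ c).
  rw [h1, single_tmul_one hγ, Finset.sum_mul]
  refine Submodule.sum_mem _ fun i _ => Submodule.subset_span
    ⟨Pi.single i 1, pathCoeff k Γ j i * b, ?_⟩
  rw [mul_assoc, ← MinTensor.tmul_mul, one_mul]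

/-- The coaction of `G_k^+(Γ)` on the path space. -/
def pathCoaction (Γ : SimpleGraph V) [DecidableRel Γ.Adj] (hγ : γ ≤ k) :
    Coaction (quantumGroup k Γ) (PathSpace Γ γ → ℂ) where
  hom := pathHom Γ hγ
  coaction := pathHom_coaction hγ
  dense := dense_pathHom hγ

end PathCoaction

end

/-- Extension by zero is injective and stays so after tensoring over ℂ. The first condition on v
therefore both expresses that u^{⊗(γ+1)} preserves C(E^γ) and determines v as the restriction; the
second says that this restriction, read in the minimal tensor product, is the underlying map of a
coaction. Being a unital *-homomorphism is part of the type of `α.hom`. -/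
theorem mainTheorem3 {V : Type u} [Fintype V] [DecidableEq V] (Γ : SimpleGraph V)
    [DecidableRel Γ.Adj] (k γ : ℕ) (hγ : γ ≤ k) :
    ∃ v : (PathSpace Γ γ → ℂ) →ₗ[ℂ] (PathSpace Γ γ → ℂ) ⊗[ℂ] QuantumAlgebra k Γ,
      (∀ f, (pathIncl Γ γ).rTensor (QuantumAlgebra k Γ) (v f) =
        tensorPower k Γ (γ + 1) (pathIncl Γ γ f)) ∧
      ∃ α : Coaction (quantumGroup k Γ) (PathSpace Γ γ → ℂ),
        ∀ f, α.hom f = MinTensor.ofAlg (PathSpace Γ γ → ℂ) (QuantumAlgebra k Γ) (v f) :=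
  ⟨pathCorep k Γ γ, rTensor_pathCorep, pathCoaction Γ hγ, pathHom_apply hγ⟩
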